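/- Let $S\subset\mathbb{R}^2$ be a simply connected, bounded domain with smooth boundary and let $k\in C^\infty(\overline S)$. Set $$W^{2,2}_k(S)=\{v\in W^{2,2}(S) : \det\nabla^2 v=k \text{ almost everywhere in } S\},$$ $$\mathcal W_k(v)=\begin{cases}\int_S|\nabla^2v(x)|^2\,dx & \text{if } v\in W^{2,2}_k(S),\\ +\infty & \text{otherwise,}\end{cases}$$ where $\nabla^2 v$ is the weak Hessian and $|\cdot|$ is the Frobenius norm. Then $\mathcal W_k$ attains its minimum: there is $v\in W^{2,2}(S)$ with $\mathcal W_k(v)\le\mathcal W_k(w)$ for all $w$, and if $W^{2,2}_k(S)\neq\emptyset$ then $v$ can be taken in $W^{2,2}_k(S)$. (If $W^{2,2}_k(S)=\emptyset$, then $\mathcal W_k\equiv+\infty$ and the claim is trivial.) -/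

import Mathlib

open Set MeasureTheory
open scoped ContDiff ENNReal

noncomputable section

namespace VonKarman

/-- The Euclidean plane. -/
abbrev Plane : Type := EuclideanSpace ℝ (Fin 2)

/-- The boundary of `S` is smooth: near each boundary point, after an orthogonal change of
coordinates, `S` is the region strictly above the graph of a smooth function of one variable. -/
def HasSmoothBoundary (S : Set Plane) : Prop :=
  ∀ p ∈ frontier S, ∃ (e : Plane ≃ₗᵢ[ℝ] Plane) (γ : ℝ → ℝ) (r : ℝ),
    ContDiff ℝ ∞ γ ∧ 0 < r ∧ ∀ x ∈ Metric.ball p r, (x ∈ S ↔ γ (e x 0) < e x 1)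

/-- A bounded, simply connected domain of the plane with smooth boundary. (`IsSimplyConnected`
includes that `S` is nonempty and path connected.) -/
structure IsSmoothSimplyConnectedDomain (S : Set Plane) : Prop where
  isOpen : IsOpen S
  isSimplyConnected : IsSimplyConnected S
  isBounded : Bornology.IsBounded S
  smoothBoundary : HasSmoothBoundary S

/-- Test functions on `S`: smooth functions with compact support contained in `S`. -/
def IsTestFunction (S : Set Plane) (φ : Plane → ℝ) : Prop :=
  ContDiff ℝ ∞ φ ∧ HasCompactSupport φ ∧ tsupport φ ⊆ S

/-- `g` is a weak `i`-th partial derivative of `u` on `S`. -/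
def HasWeakPartial (S : Set Plane) (i : Fin 2) (u g : Plane → ℝ) : Prop :=
  LocallyIntegrableOn u S ∧ LocallyIntegrableOn g S ∧
    ∀ φ : Plane → ℝ, IsTestFunction S φ →
      ∫ x in S, u x * fderiv ℝ φ x (EuclideanSpace.single i 1) = -∫ x in S, g x * φ x

/-- The weak `i`-th partial derivative of `u` on `S` (unique up to null sets on an open set `S`);
zero if there is none. -/
def weakPartial (S : Set Plane) (i : Fin 2) (u : Plane → ℝ) : Plane → ℝ :=
  open Classical in
  if h : ∃ g, HasWeakPartial S i u g then h.choose else 0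

/-- The weak Hessian `∇²v`, with entries `∂ⱼ∂ᵢv`. -/
def weakHessian (S : Set Plane) (v : Plane → ℝ) (x : Plane) : Matrix (Fin 2) (Fin 2) ℝ :=
  Matrix.of fun i j => weakPartial S j (weakPartial S i v) x

/-- The Sobolev space `W^{2,2}(S)`: functions in `L²(S)` whose weak partial derivatives of first
and second order exist and lie in `L²(S)`. The values of the functions outside `S` play no role. -/
def W22 (S : Set Plane) : Set (Plane → ℝ) :=
  {v | MemLp v 2 (volume.restrict S) ∧
    ∀ i, ∃ g, HasWeakPartial S i v g ∧ MemLp g 2 (volume.restrict S) ∧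
      ∀ j, ∃ h, HasWeakPartial S j g h ∧ MemLp h 2 (volume.restrict S)}

/-- The constrained space `W^{2,2}_k(S)`: those `v ∈ W^{2,2}(S)` with `det ∇²v = k` almost
everywhere in `S`. -/
def W22k (S : Set Plane) (k : Plane → ℝ) : Set (Plane → ℝ) :=
  {v | v ∈ W22 S ∧ ∀ᵐ x ∂(volume.restrict S), (weakHessian S v x).det = k x}

/-- The functional `𝒲ₖ`: the integral over `S` of the squared Frobenius norm of `∇²v` if
`v ∈ W^{2,2}_k(S)`, and `+∞` otherwise. -/
def energy (S : Set Plane) (k : Plane → ℝ) (v : Plane → ℝ) : ℝ≥0∞ :=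
  open Classical in
  if v ∈ W22k S k then
    ∫⁻ x in S, ENNReal.ofReal (∑ i, ∑ j, (weakHessian S v x i j) ^ 2)
  else ⊤

end VonKarman

end

/-! The proof is the direct method. A minimizing sequence has bounded Hessians in L². Subtracting
affine functions changes neither the Hessian nor its determinant, and by the Poincaré inequality
(`poincareOn_self`, used through `exists_normalized_of_poincare`) the functions and gradients can
then be bounded too. A subsequence along which functions, gradients and Hessians all converge weakly
in L² has a limit in W^{2,2}, and the energy is weakly lower semicontinuous because it is a sum of
squared L² norms.

The difficulty is that the constraint is quadratic in the Hessian, so weak convergence alone does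
not preserve it. What saves it is the null Lagrangian structure: with f = ∂₀v and g = ∂₁v, det ∇²v
is the Jacobian of (f, g), and tested against φ it equals -∫ f (∂₁g ∂₀φ - ∂₀g ∂₁φ)
(`IsWeakGradient.integral_jacobian_mul`). The right side is linear in ∇g, which converges weakly,
and f converges strongly in L² on the support of φ by a local Rellich theorem
(`tendsto_lintegral_sq_of_weak`). Hence the constraint passes to the limit
(`jacobian_ae_eq_of_tendsto`).

Poincaré and Rellich both rest on one estimate, `lintegral_sq_translate_sub_le`: the L² size of u(·
+ w) - u is at most |w| times that of the gradient, as long as the segments stay in S. It is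
obtained by duality with test functions, without smooth approximation of u. Boundary regularity
enters only in the Poincaré inequality: near a boundary point, S can be pushed inwards along the
graph direction. -/

namespace VonKarman

open Filter Topology

variable {S : Set Plane}

/-- The `i`-th vector of the standard basis of the plane. -/
noncomputable abbrev basisVec (i : Fin 2) : Plane := EuclideanSpace.single i (1 : ℝ)

/-! ### Calculus of test functions -/

namespace IsTestFunction

variable {φ ψ : Plane → ℝ}

lemma continuous (h : IsTestFunction S φ) : Continuous φ := h.1.continuous

lemma eq_zero_of_notMem (h : IsTestFunction S φ) {x : Plane} (hx : x ∉ S) : φ x = 0 :=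
  image_eq_zero_of_notMem_tsupport fun hx' => hx (h.2.2 hx')

lemma mono {T : Set Plane} (h : IsTestFunction S φ) (hST : S ⊆ T) : IsTestFunction T φ :=
  ⟨h.1, h.2.1, h.2.2.trans hST⟩

lemma mul_contDiff (h : IsTestFunction S φ) (hψ : ContDiff ℝ ∞ ψ) :
    IsTestFunction S fun x => φ x * ψ x :=
  ⟨h.1.mul hψ, h.2.1.mul_right, (tsupport_mul_subset_left).trans h.2.2⟩

lemma add (h : IsTestFunction S φ) (h' : IsTestFunction S ψ) :
    IsTestFunction S fun x => φ x + ψ x :=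
  ⟨h.1.add h'.1, h.2.1.add h'.2.1, (tsupport_add φ ψ).trans (union_subset h.2.2 h'.2.2)⟩

lemma const_mul (h : IsTestFunction S φ) (c : ℝ) : IsTestFunction S fun x => c * φ x := by
  simpa only [mul_comm] using h.mul_contDiff (contDiff_const (c := c))

lemma zero : IsTestFunction S fun _ => 0 :=
  ⟨contDiff_const, HasCompactSupport.zero, by
    have : tsupport (fun _ : Plane => (0 : ℝ)) = ∅ := tsupport_eq_empty_iff.2 rfl
    simp [this]⟩

lemma fderiv_apply (h : IsTestFunction S φ) (w : Plane) :
    IsTestFunction S fun x => fderiv ℝ φ x w :=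
  ⟨(h.1.fderiv_right (m := ∞) (by simp)).clm_apply contDiff_const, h.2.1.fderiv_apply (𝕜 := ℝ) w,
    (tsupport_fderiv_apply_subset ℝ w).trans h.2.2⟩

/-- Reflections and translations of test functions. -/
lemma comp_homeomorph (h : IsTestFunction S φ) (e : Plane ≃ₜ Plane) (he : ContDiff ℝ ∞ e)
    {T : Set Plane} (hT : ∀ y, e y ∈ tsupport φ → y ∈ T) :
    IsTestFunction T fun y => φ (e y) :=
  ⟨h.1.comp he, h.2.1.comp_homeomorph e, fun y hy => hT y (by
    have := tsupport_comp_eq_preimage φ e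
    rw [show (fun y => φ (e y)) = φ ∘ e from rfl, this] at hy
    exact hy)⟩

lemma comp_sub (h : IsTestFunction S φ) (w : Plane) {T : Set Plane}
    (hT : ∀ x ∈ tsupport φ, x + w ∈ T) : IsTestFunction T fun y => φ (y - w) :=
  h.comp_homeomorph (Homeomorph.subRight w) (contDiff_id.sub contDiff_const) fun y hy => by
    simpa using hT _ hy

lemma comp_const_sub (h : IsTestFunction S φ) (w : Plane) {T : Set Plane}
    (hT : ∀ x ∈ tsupport φ, w - x ∈ T) : IsTestFunction T fun y => φ (w - y) :=
  h.comp_homeomorph (Homeomorph.subLeft w) (contDiff_const.sub contDiff_id) fun y hy => by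
    simpa using hT _ hy

lemma memLp (h : IsTestFunction S φ) (p : ℝ≥0∞) (μ : Measure Plane)
    [IsFiniteMeasureOnCompacts μ] : MemLp φ p μ :=
  h.continuous.memLp_of_hasCompactSupport h.2.1

lemma exists_bound (h : IsTestFunction S φ) : ∃ C, ∀ x, |φ x| ≤ C := by
  simpa using h.2.1.exists_bound_of_continuous h.continuous

lemma setIntegral_eq (h : IsTestFunction S φ) (f : Plane → ℝ) :
    ∫ x in S, f x * φ x = ∫ x, f x * φ x :=
  setIntegral_eq_integral_of_forall_compl_eq_zero fun x hx => by
    rw [h.eq_zero_of_notMem hx, mul_zero]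

lemma integrableOn_mul (h : IsTestFunction S φ) {f : Plane → ℝ}
    (hf : LocallyIntegrableOn f S) : IntegrableOn (fun x => f x * φ x) S := by
  have h1 : IntegrableOn (fun x => f x * φ x) (tsupport φ) :=
    (hf.integrableOn_compact_subset h.2.2 h.2.1).mul_continuousOn h.continuous.continuousOn h.2.1
  have h2 : Integrable (fun x => f x * φ x) := by
    rwa [integrableOn_iff_integrable_of_support_subset] at h1
    intro x hx
    exact subset_tsupport _ fun h0 => hx (by simp [h0])
  exact h2.integrableOn

lemma integrable_mul_of_memLp (h : IsTestFunction S φ) {f : Plane → ℝ} {μ : Measure Plane}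
    [IsFiniteMeasureOnCompacts μ] (hf : MemLp f 2 μ) :
    Integrable (fun x => f x * φ x) μ :=
  hf.integrable_mul (h.memLp 2 μ)

end IsTestFunction

/-! ### Uniqueness of weak derivatives -/

lemma ae_eq_zero_of_integral_test (hS : IsOpen S) {f : Plane → ℝ}
    (hf : LocallyIntegrableOn f S)
    (h : ∀ φ, IsTestFunction S φ → ∫ x in S, f x * φ x = 0) :
    f =ᵐ[volume.restrict S] 0 := by
  refine (ae_restrict_iff' hS.measurableSet).2
    (hS.ae_eq_zero_of_integral_contDiff_smul_eq_zero hf fun φ h1 h2 h3 => ?_)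
  have hφ : IsTestFunction S φ := ⟨h1, h2, h3⟩
  rw [← h φ hφ, hφ.setIntegral_eq]
  simp only [smul_eq_mul, mul_comm]

lemma _root_.MeasureTheory.LocallyIntegrableOn.congr_ae_restrict {f f' : Plane → ℝ}
    (hf : LocallyIntegrableOn f S) (h : f =ᵐ[volume.restrict S] f') :
    LocallyIntegrableOn f' S := by
  intro x hx
  obtain ⟨U, hU, hU'⟩ := hf x hx
  refine ⟨U ∩ S, inter_mem hU self_mem_nhdsWithin, ?_⟩
  refine (hU'.mono_set inter_subset_left).congr_fun_ae ?_
  exact ae_mono (Measure.restrict_mono_set _ inter_subset_right) h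

namespace HasWeakPartial

variable {i : Fin 2} {u u' g g' : Plane → ℝ}

lemma congr (h : HasWeakPartial S i u g) (hu : u =ᵐ[volume.restrict S] u')
    (hg : g =ᵐ[volume.restrict S] g') : HasWeakPartial S i u' g' := by
  refine ⟨h.1.congr_ae_restrict hu, h.2.1.congr_ae_restrict hg,
    fun φ hφ => ?_⟩
  have h1 : ∫ x in S, u x * fderiv ℝ φ x (basisVec i) =
      ∫ x in S, u' x * fderiv ℝ φ x (basisVec i) :=
    integral_congr_ae (hu.mul (ae_eq_refl _))
  have h2 : ∫ x in S, g x * φ x = ∫ x in S, g' x * φ x :=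
    integral_congr_ae (hg.mul (ae_eq_refl _))
  rw [← h1, ← h2]
  exact h.2.2 φ hφ

lemma ae_eq (hS : IsOpen S) (h : HasWeakPartial S i u g) (h' : HasWeakPartial S i u g') :
    g =ᵐ[volume.restrict S] g' := by
  have := ae_eq_zero_of_integral_test hS (h.2.1.sub h'.2.1) fun φ hφ => by
    have h1 := h.2.2 φ hφ
    rw [h'.2.2 φ hφ] at h1
    simp only [Pi.sub_apply, sub_mul]
    rw [integral_sub (hφ.integrableOn_mul h.2.1) (hφ.integrableOn_mul h'.2.1)]
    linarith
  filter_upwards [this] with x hx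
  exact sub_eq_zero.1 hx

end HasWeakPartial

lemma weakPartial_ae_eq (hS : IsOpen S) {i : Fin 2} {u g : Plane → ℝ}
    (h : HasWeakPartial S i u g) : weakPartial S i u =ᵐ[volume.restrict S] g := by
  have hex : ∃ g, HasWeakPartial S i u g := ⟨g, h⟩
  rw [weakPartial, dif_pos hex]
  exact hex.choose_spec.ae_eq hS h


/-! ### Duality between L² and test functions -/

lemma _root_.MeasureTheory.MemLp.inner_toLp_eq {α : Type*} [MeasurableSpace α] {μ : Measure α}
    {f g : α → ℝ} (hf : MemLp f 2 μ) (hg : MemLp g 2 μ) :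
    inner ℝ (hf.toLp f) (hg.toLp g) = ∫ x, f x * g x ∂μ := by
  rw [L2.inner_def]
  refine integral_congr_ae ?_
  filter_upwards [hf.coeFn_toLp, hg.coeFn_toLp] with x h1 h2
  rw [h1, h2]
  simp [mul_comm]

lemma _root_.MeasureTheory.MemLp.norm_toLp_sq {α : Type*} [MeasurableSpace α] {μ : Measure α}
    {f : α → ℝ} (hf : MemLp f 2 μ) : ‖hf.toLp f‖ ^ 2 = ∫ x, f x ^ 2 ∂μ := by
  rw [← real_inner_self_eq_norm_sq, hf.inner_toLp_eq hf]
  simp only [sq]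

lemma _root_.MeasureTheory.MemLp.sq_integral_mul_le {α : Type*} [MeasurableSpace α]
    {μ : Measure α} {f g : α → ℝ} (hf : MemLp f 2 μ) (hg : MemLp g 2 μ) :
    (∫ x, f x * g x ∂μ) ^ 2 ≤ (∫ x, f x ^ 2 ∂μ) * ∫ x, g x ^ 2 ∂μ := by
  rw [← hf.inner_toLp_eq hg, ← hf.norm_toLp_sq, ← hg.norm_toLp_sq, ← mul_pow, ← sq_abs]
  gcongr
  exact abs_real_inner_le_norm _ _

/-- Test functions, as a subspace of `L²(S)`. -/
def testSubmodule (S : Set Plane) : Submodule ℝ (Lp ℝ 2 (volume.restrict S)) where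
  carrier := {F | ∃ φ, IsTestFunction S φ ∧ F =ᵐ[volume.restrict S] φ}
  zero_mem' := ⟨_, .zero, Lp.coeFn_zero _ _ _⟩
  add_mem' := by
    rintro F G ⟨φ, hφ, hF⟩ ⟨ψ, hψ, hG⟩
    exact ⟨_, hφ.add hψ, (Lp.coeFn_add F G).trans (hF.add hG)⟩
  smul_mem' := by
    rintro c F ⟨φ, hφ, hF⟩
    exact ⟨_, hφ.const_mul c, (Lp.coeFn_smul c F).trans (hF.const_smul c)⟩

/-- An element orthogonal to all test functions vanishes by the fundamental lemma of the calculus of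
variations. -/
lemma topologicalClosure_testSubmodule (hS : IsOpen S) :
    (testSubmodule S).topologicalClosure = ⊤ := by
  rw [Submodule.topologicalClosure_eq_top_iff, Submodule.eq_bot_iff]
  intro F hF
  rw [Submodule.mem_orthogonal'] at hF
  have hFm := Lp.memLp F
  refine (Lp.eq_zero_iff_ae_eq_zero).2 (ae_eq_zero_of_integral_test hS
    (locallyIntegrableOn_of_locallyIntegrable_restrict (hFm.locallyIntegrable (by norm_num)))
    fun φ hφ => ?_)
  have hm := hφ.memLp 2 (volume.restrict S)
  have := hF (hm.toLp φ) ⟨φ, hφ, hm.coeFn_toLp⟩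
  rw [← Lp.toLp_coeFn F hFm, hFm.inner_toLp_eq hm] at this
  exact this

/-- The `L²` norm is tested by test functions. -/
lemma integral_sq_le_of_test (hS : IsOpen S) {f : Plane → ℝ}
    (hf : MemLp f 2 (volume.restrict S)) {B : ℝ} (hB0 : 0 ≤ B)
    (h : ∀ φ, IsTestFunction S φ → (∫ x in S, f x * φ x) ^ 2 ≤ B * ∫ x in S, φ x ^ 2) :
    ∫ x in S, f x ^ 2 ≤ B := by
  have hB : ∀ F : Lp ℝ 2 (volume.restrict S), inner ℝ (hf.toLp f) F ^ 2 ≤ B * ‖F‖ ^ 2 := by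
    have hcl : IsClosed {F : Lp ℝ 2 (volume.restrict S) |
        inner ℝ (hf.toLp f) F ^ 2 ≤ B * ‖F‖ ^ 2} :=
      isClosed_le (by fun_prop) (by fun_prop)
    have hsub : (testSubmodule S : Set (Lp ℝ 2 (volume.restrict S))) ⊆
        {F | inner ℝ (hf.toLp f) F ^ 2 ≤ B * ‖F‖ ^ 2} := by
      rintro F ⟨φ, hφ, hF⟩
      have hm := hφ.memLp 2 (volume.restrict S)
      have : F = hm.toLp φ := Lp.ext (hF.trans hm.coeFn_toLp.symm)
      rw [Set.mem_ofPred_eq, this, hf.inner_toLp_eq hm, hm.norm_toLp_sq]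
      exact h φ hφ
    intro F
    have hF : F ∈ (testSubmodule S).topologicalClosure := by
      rw [topologicalClosure_testSubmodule hS]; trivial
    exact closure_minimal hsub hcl hF
  -- By density F = f is admissible, which gives ‖f‖⁴ ≤ B‖f‖².
  have h1 := hB (hf.toLp f)
  rw [real_inner_self_eq_norm_sq] at h1
  rw [← hf.norm_toLp_sq]
  rcases eq_or_lt_of_le (sq_nonneg ‖hf.toLp f‖) with h0 | h0
  · rwa [← h0]
  · nlinarith

end VonKarman

/-! ### The translation estimate -/

namespace VonKarman

open Filter Topology

variable {S D : Set Plane} {φ u : Plane → ℝ} {g : Fin 2 → Plane → ℝ}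

lemma eq_sum_basisVec (w : Plane) : w = ∑ i, w i • basisVec i := by
  ext j
  fin_cases j <;> simp [Fin.sum_univ_two]

lemma IsTestFunction.exists_bound_fderiv (h : IsTestFunction S φ) : ∃ C, ∀ x, ‖fderiv ℝ φ x‖ ≤ C :=
  (h.2.1.fderiv (𝕜 := ℝ)).exists_bound_of_continuous (h.1.continuous_fderiv (by simp))

/-- Derivative of a translated test function. -/
lemma fderiv_comp_sub_apply (w y : Plane) (i : Fin 2) :
    fderiv ℝ (fun y => φ (y - w)) y (basisVec i) = fderiv ℝ φ (y - w) (basisVec i) := by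
  rw [fderiv_comp_sub]

/-- The derivative falls on the smooth factor φ, so no weak derivative of u is needed and the
translated support may leave S. -/
lemma hasDerivAt_integral_translate (hφ : IsTestFunction D φ) {w : Plane}
    (hu : MemLp u 2 (volume.restrict S)) (hSb : volume S ≠ ⊤) (t : ℝ) :
    HasDerivAt (fun t : ℝ => ∫ y in S, u y * φ (y - t • w))
      (-∫ y in S, u y * fderiv ℝ φ (y - t • w) w) t := by
  obtain ⟨C, hC⟩ := hφ.exists_bound_fderiv
  have : IsFiniteMeasure (volume.restrict S) := ⟨by simpa using hSb.lt_top⟩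
  have hui : Integrable u (volume.restrict S) := hu.integrable (by norm_num)
  have hcont : ∀ t : ℝ, Continuous fun y => φ (y - t • w) := fun t =>
    hφ.continuous.comp (by fun_prop)
  have hcont' : ∀ t : ℝ, Continuous fun y => fderiv ℝ φ (y - t • w) w := fun t =>
    ((hφ.fderiv_apply w).continuous).comp (g := fun x => fderiv ℝ φ x w) (f := fun y => y - t • w)
      (by fun_prop)
  obtain ⟨B, hB⟩ := hφ.exists_bound
  rw [← integral_neg]
  refine (hasDerivAt_integral_of_dominated_loc_of_deriv_le (s := univ)
    (F := fun t y => u y * φ (y - t • w)) (F' := fun t y => -(u y * fderiv ℝ φ (y - t • w) w))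
    (bound := fun y => ‖u y‖ * (C * ‖w‖)) univ_mem
    (.of_forall fun t => hui.1.mul (hcont t).aestronglyMeasurable) ?_
    (hui.1.mul (hcont' t).aestronglyMeasurable).neg ?_ (hui.norm.mul_const _) ?_).2
  · exact hui.mul_bdd (c := B) (hcont t).aestronglyMeasurable (.of_forall fun y => hB _)
  · refine .of_forall fun y s _ => ?_
    rw [norm_neg, norm_mul]
    gcongr
    exact (ContinuousLinearMap.le_opNorm _ _).trans (by gcongr; exact hC _)
  · refine .of_forall fun y s _ => ?_
    have h1 : HasDerivAt (fun s : ℝ => y - s • w) (-w) s := by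
      simpa using ((hasDerivAt_id s).smul_const w).const_sub y
    have h2 : HasFDerivAt φ (fderiv ℝ φ (y - s • w)) (y - s • w) :=
      (hφ.1.differentiable (by simp) _).hasFDerivAt
    have := (h2.comp_hasDerivAt s h1).const_mul (u y)
    simpa using this

/-- Along a segment on which the translated support stays in `S`, a weak gradient controls
the change of the tested function. -/
lemma sq_integral_translate_sub_le (hφ : IsTestFunction D φ) {w : Plane}
    (hDS : ∀ x ∈ D, ∀ t ∈ Icc (0 : ℝ) 1, x + t • w ∈ S)
    (hu : MemLp u 2 (volume.restrict S)) (hSb : volume S ≠ ⊤)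
    (hg : ∀ i, MemLp (g i) 2 (volume.restrict S)) (hw : ∀ i, HasWeakPartial S i u (g i)) :
    (∫ y in S, u y * φ (y - w) - u y * φ y) ^ 2 ≤
      (∫ y in S, (∑ i, w i * g i y) ^ 2) * ∫ y in D, φ y ^ 2 := by
  have hG : MemLp (fun y => ∑ i, w i * g i y) 2 (volume.restrict S) :=
    memLp_finsetSum _ fun i _ => (hg i).const_mul (w i)
  have htest : ∀ t ∈ Icc (0 : ℝ) 1, IsTestFunction S fun y => φ (y - t • w) := fun t ht =>
    hφ.comp_sub _ fun x hx => hDS x (hφ.2.2 hx) t ht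
  -- For t in [0,1] the translate of φ is a test function on S, so the derivative moves onto u and
  -- becomes w · g.
  have hderiv : ∀ t ∈ Icc (0 : ℝ) 1, -∫ y in S, u y * fderiv ℝ φ (y - t • w) w =
      ∫ y in S, (∑ i, w i * g i y) * φ (y - t • w) := by
    intro t ht
    have h1 : ∀ y, u y * fderiv ℝ φ (y - t • w) w =
        ∑ i, w i * (u y * fderiv ℝ (fun y => φ (y - t • w)) y (basisVec i)) := by
      intro y
      conv_lhs => rw [eq_sum_basisVec w, map_sum, ← eq_sum_basisVec w, Finset.mul_sum]
      refine Finset.sum_congr rfl fun i _ => ?_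
      rw [fderiv_comp_sub_apply, map_smul, smul_eq_mul]
      ring
    have h2 : ∀ y, (∑ i, w i * g i y) * φ (y - t • w) =
        ∑ i, w i * (g i y * φ (y - t • w)) := by
      intro y
      rw [Finset.sum_mul]
      exact Finset.sum_congr rfl fun i _ => by ring
    simp_rw [h1, h2]
    rw [integral_finsetSum, integral_finsetSum, ← Finset.sum_neg_distrib]
    · refine Finset.sum_congr rfl fun i _ => ?_
      rw [integral_const_mul, integral_const_mul, (hw i).2.2 _ (htest t ht), mul_neg, neg_neg]
    · exact fun i _ => ((htest t ht).integrable_mul_of_memLp (hg i)).const_mul _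
    · exact fun i _ => (((htest t ht).fderiv_apply _).integrable_mul_of_memLp hu).const_mul _
  set A := ∫ y in S, (∑ i, w i * g i y) ^ 2
  set B := ∫ y in D, φ y ^ 2 with hBdef
  have hA0 : 0 ≤ A := integral_nonneg fun y => sq_nonneg _
  have hB0 : 0 ≤ B := integral_nonneg fun y => sq_nonneg _
  -- Translation invariance makes the norm of φ independent of t, so Cauchy–Schwarz bounds the
  -- t-derivative uniformly by √(A * B), and the mean value inequality applies.
  have hBt : ∀ t ∈ Icc (0 : ℝ) 1, ∫ y in S, φ (y - t • w) ^ 2 = B := by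
    intro t ht
    have h1 := (htest t ht).setIntegral_eq fun y => φ (y - t • w)
    have h2 := hφ.setIntegral_eq φ
    simp only [← sq] at h1 h2
    rw [h1, hBdef, h2, integral_sub_right_eq_self fun y => φ y ^ 2]
  have key := norm_image_sub_le_of_norm_deriv_le_segment_01'
    (f := fun t : ℝ => ∫ y in S, u y * φ (y - t • w))
    (f' := fun t => -∫ y in S, u y * fderiv ℝ φ (y - t • w) w) (C := √(A * B))
    (fun t _ => (hasDerivAt_integral_translate hφ hu hSb t).hasDerivWithinAt) (fun t ht => by
      have ht' := Ico_subset_Icc_self ht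
      rw [hderiv t ht', Real.norm_eq_abs, ← Real.sqrt_sq_eq_abs]
      refine Real.sqrt_le_sqrt ?_
      rw [← hBt t ht']
      exact hG.sq_integral_mul_le ((htest t ht').memLp 2 _))
  simp only [one_smul, zero_smul, sub_zero, Real.norm_eq_abs] at key
  have h1 := (htest 1 (by simp)).integrable_mul_of_memLp hu
  have h0 := (htest 0 (by simp)).integrable_mul_of_memLp hu
  simp only [one_smul, zero_smul, sub_zero] at h1 h0
  rw [integral_sub h1 h0, ← sq_abs]
  calc _ ≤ √(A * B) ^ 2 := by gcongr
    _ = A * B := Real.sq_sqrt (mul_nonneg hA0 hB0)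

lemma memLp_comp_add {w : Plane} (hDw : ∀ x ∈ D, x + w ∈ S)
    (hS : MeasurableSet S) (hu : MemLp u 2 (volume.restrict S)) :
    MemLp (fun x => u (x + w)) 2 (volume.restrict D) := by
  have h1 : MeasurePreserving (· + w) (volume.restrict ((· + w) ⁻¹' S)) (volume.restrict S) :=
    (measurePreserving_add_right volume w).restrict_preimage hS
  exact (hu.comp_measurePreserving h1).mono_measure (Measure.restrict_mono_set _ hDw)

/-- Dual form of the previous bound: a change of variables moves the translation from φ to u, and
the L² norm is recovered by testing. -/
lemma integral_sq_translate_sub_le (hS : IsOpen S) (hD : IsOpen D) {w : Plane}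
    (hDS : ∀ x ∈ D, ∀ t ∈ Icc (0 : ℝ) 1, x + t • w ∈ S)
    (hu : MemLp u 2 (volume.restrict S)) (hSb : volume S ≠ ⊤)
    (hg : ∀ i, MemLp (g i) 2 (volume.restrict S)) (hw : ∀ i, HasWeakPartial S i u (g i)) :
    ∫ x in D, (u (x + w) - u x) ^ 2 ≤ ∫ y in S, (∑ i, w i * g i y) ^ 2 := by
  have hDS0 : D ⊆ S := fun x hx => by simpa using hDS x hx 0 (by simp)
  have hDS1 : ∀ x ∈ D, x + w ∈ S := fun x hx => by simpa using hDS x hx 1 (by simp)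
  have hm1 := memLp_comp_add hDS1 hS.measurableSet hu
  have hm0 := hu.mono_measure (Measure.restrict_mono_set volume hDS0)
  refine integral_sq_le_of_test hD (hm1.sub hm0) (integral_nonneg fun y => sq_nonneg _)
    fun φ hφ => ?_
  convert sq_integral_translate_sub_le hφ hDS hu hSb hg hw using 2
  have ht1 : IsTestFunction S fun y => φ (y - w) :=
    hφ.comp_sub _ fun x hx => hDS1 x (hφ.2.2 hx)
  have ht0 := hφ.mono hDS0
  simp only [Pi.sub_apply, sub_mul]
  rw [integral_sub (hφ.integrable_mul_of_memLp hm1) (hφ.integrable_mul_of_memLp hm0),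
    integral_sub (ht1.integrable_mul_of_memLp hu) (ht0.integrable_mul_of_memLp hu),
    hφ.setIntegral_eq, hφ.setIntegral_eq, ht1.setIntegral_eq, ht0.setIntegral_eq,
    ← integral_sub_right_eq_self (fun x => u (x + w) * φ x) w]
  simp

/-- The Dirichlet energy of a vector field. -/
noncomputable def gradSq (S : Set Plane) (g : Fin 2 → Plane → ℝ) : ℝ≥0∞ :=
  ∑ i, ∫⁻ x in S, ‖g i x‖ₑ ^ 2

lemma enorm_sq_eq_ofReal (x : ℝ) : ‖x‖ₑ ^ 2 = ENNReal.ofReal (x ^ 2) := by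
  rw [← sq_abs, ENNReal.ofReal_pow (abs_nonneg _), ← Real.norm_eq_abs, ofReal_norm]

lemma _root_.MeasureTheory.MemLp.lintegral_enorm_sq {α : Type*} [MeasurableSpace α]
    {μ : Measure α} {f : α → ℝ} (hf : MemLp f 2 μ) :
    ∫⁻ x, ‖f x‖ₑ ^ 2 ∂μ = ENNReal.ofReal (∫ x, f x ^ 2 ∂μ) := by
  rw [ofReal_integral_eq_lintegral_ofReal hf.integrable_sq (.of_forall fun x => sq_nonneg _)]
  exact lintegral_congr fun x => enorm_sq_eq_ofReal _

lemma gradSq_eq_ofReal {g : Fin 2 → Plane → ℝ} (hg : ∀ i, MemLp (g i) 2 (volume.restrict S)) :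
    gradSq S g = ENNReal.ofReal (∑ i, ∫ x in S, g i x ^ 2) := by
  rw [gradSq, ENNReal.ofReal_sum_of_nonneg fun i _ => integral_nonneg fun x => sq_nonneg _]
  exact Finset.sum_congr rfl fun i _ => (hg i).lintegral_enorm_sq

lemma lintegral_sq_translate_sub_le (hS : IsOpen S) (hD : IsOpen D) {w : Plane}
    (hDS : ∀ x ∈ D, ∀ t ∈ Icc (0 : ℝ) 1, x + t • w ∈ S)
    (hu : MemLp u 2 (volume.restrict S)) (hSb : volume S ≠ ⊤)
    (hg : ∀ i, MemLp (g i) 2 (volume.restrict S)) (hw : ∀ i, HasWeakPartial S i u (g i)) :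
    ∫⁻ x in D, ‖u (x + w) - u x‖ₑ ^ 2 ≤ ‖w‖ₑ ^ 2 * gradSq S g := by
  have hDS0 : D ⊆ S := fun x hx => by simpa using hDS x hx 0 (by simp)
  have hDS1 : ∀ x ∈ D, x + w ∈ S := fun x hx => by simpa using hDS x hx 1 (by simp)
  have hm1 := memLp_comp_add hDS1 hS.measurableSet hu
  have hm0 := hu.mono_measure (Measure.restrict_mono_set volume hDS0)
  have hm : MemLp (fun x => u (x + w) - u x) 2 (volume.restrict D) := hm1.sub hm0
  have hw2 : ‖w‖ₑ ^ 2 = ENNReal.ofReal (∑ i, w i ^ 2) := by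
    rw [← ofReal_norm, ← ENNReal.ofReal_pow (norm_nonneg _), EuclideanSpace.norm_sq_eq]
    simp
  rw [hm.lintegral_enorm_sq, hw2, gradSq_eq_ofReal hg,
    ← ENNReal.ofReal_mul (Finset.sum_nonneg fun i _ => sq_nonneg _)]
  refine ENNReal.ofReal_le_ofReal
    ((integral_sq_translate_sub_le hS hD hDS hu hSb hg hw).trans ?_)
  rw [← integral_finsetSum _ fun i _ => (hg i).integrable_sq, ← integral_const_mul]
  refine integral_mono (memLp_finsetSum _ fun i _ => (hg i).const_mul (w i)).integrable_sq
    ((integrable_finsetSum _ fun i _ => (hg i).integrable_sq).const_mul _) fun x => ?_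
  exact Finset.sum_mul_sq_le_sq_mul_sq _ _ _

end VonKarman

/-! ### The Poincaré inequality -/

namespace VonKarman

open Filter Topology

variable {S U V : Set Plane} {u : Plane → ℝ} {g : Fin 2 → Plane → ℝ}

/-- `u ∈ W^{1,2}(S)` with weak gradient `g`. -/
structure IsWeakGradient (S : Set Plane) (u : Plane → ℝ) (g : Fin 2 → Plane → ℝ) : Prop where
  memLp : MemLp u 2 (volume.restrict S)
  memLp_grad : ∀ i, MemLp (g i) 2 (volume.restrict S)
  hasWeakPartial : ∀ i, HasWeakPartial S i u (g i)

lemma enorm_sub_sq_le (a b c : ℝ) : ‖a - c‖ₑ ^ 2 ≤ 2 * ‖a - b‖ₑ ^ 2 + 2 * ‖b - c‖ₑ ^ 2 := by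
  rw [enorm_sq_eq_ofReal, enorm_sq_eq_ofReal, enorm_sq_eq_ofReal,
    show (2 : ℝ≥0∞) = ENNReal.ofReal 2 by simp, ← ENNReal.ofReal_mul (by norm_num),
    ← ENNReal.ofReal_mul (by norm_num), ← ENNReal.ofReal_add (by positivity) (by positivity)]
  exact ENNReal.ofReal_le_ofReal (by nlinarith [sq_nonneg (a - b - (b - c))])

/-- A Poincaré inequality on `V`, with the Dirichlet energy on the larger set `S`. -/
def PoincareOn (S V : Set Plane) : Prop :=
  ∃ C : ℝ≥0∞, C ≠ ⊤ ∧ ∀ u g, Measurable u → IsWeakGradient S u g →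
    ∃ c : ℝ, ∫⁻ x in V, ‖u x - c‖ₑ ^ 2 ≤ C * gradSq S g

namespace PoincareOn

lemma mono (h : PoincareOn S V) (hU : U ⊆ V) : PoincareOn S U := by
  obtain ⟨C, hC, h⟩ := h
  refine ⟨C, hC, fun u g hum hu => ?_⟩
  obtain ⟨c, hc⟩ := h u g hum hu
  exact ⟨c, (lintegral_mono_set hU).trans hc⟩

/-- The constant is u(x) at a point x where the integral over y of |u(y) - u(x)|² is at most its
average over the ball. With y = x + w and Fubini, the double integral becomes an integral over w of
translation differences, controlled because a ball is convex. -/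
lemma ball (hS : IsOpen S) (hSb : volume S ≠ ⊤) {p : Plane} {r : ℝ} (hr : 0 < r)
    (hpS : Metric.ball p r ⊆ S) : PoincareOn S (Metric.ball p r) := by
  set B := Metric.ball p r with hB
  have hBm : MeasurableSet B := Metric.isOpen_ball.measurableSet
  have hB0 : volume B ≠ 0 := (Metric.isOpen_ball.measure_pos _ ⟨p, Metric.mem_ball_self hr⟩).ne'
  have hBt : volume B ≠ ⊤ := measure_ball_lt_top.ne
  set K : ℝ≥0∞ := volume (Metric.ball (0 : Plane) (2 * r)) * ENNReal.ofReal (2 * r) ^ 2 with hK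
  have hKt : K ≠ ⊤ := ENNReal.mul_ne_top measure_ball_lt_top.ne (by finiteness)
  refine ⟨(volume B)⁻¹ * K, ENNReal.mul_ne_top (by simpa using hB0) hKt, fun u g hum hu => ?_⟩
  have hmeas : Measurable fun z : Plane × Plane => ‖u z.2 - u z.1‖ₑ ^ 2 := by fun_prop
  have hF : Measurable fun x => ∫⁻ y in B, ‖u y - u x‖ₑ ^ 2 :=
    Measurable.lintegral_prod_right' (f := fun z : Plane × Plane => ‖u z.2 - u z.1‖ₑ ^ 2) hmeas
  obtain ⟨x, hx, hx'⟩ := exists_le_setLAverage hB0 hBt hF.aemeasurable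
  refine ⟨u x, hx'.trans ?_⟩
  rw [setLAverage_eq, div_eq_mul_inv, mul_comm, mul_assoc]
  gcongr
  have hone : Measurable (B.indicator (1 : Plane → ℝ≥0∞)) := measurable_one.indicator hBm
  have hind : ∀ f : Plane → ℝ≥0∞, ∫⁻ x in B, f x = ∫⁻ x, B.indicator 1 x * f x := by
    intro f
    rw [← lintegral_indicator hBm]
    refine lintegral_congr fun x => ?_
    by_cases hx : x ∈ B <;> simp [hx]
  calc ∫⁻ x in B, ∫⁻ y in B, ‖u y - u x‖ₑ ^ 2
      = ∫⁻ x, ∫⁻ w, B.indicator 1 x * (B.indicator 1 (x + w) * ‖u (x + w) - u x‖ₑ ^ 2) := by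
        rw [hind]
        refine lintegral_congr fun x => ?_
        rw [hind, ← lintegral_add_left_eq_self _ x, lintegral_const_mul]
        fun_prop
    _ = ∫⁻ w, ∫⁻ x, B.indicator 1 x * (B.indicator 1 (x + w) * ‖u (x + w) - u x‖ₑ ^ 2) := by
        refine lintegral_lintegral_swap (Measurable.aemeasurable ?_)
        have h1 : Measurable fun z : Plane × Plane => B.indicator (1 : Plane → ℝ≥0∞) (z.1 + z.2) :=
          hone.comp (by fun_prop)
        have h2 : Measurable fun z : Plane × Plane => B.indicator (1 : Plane → ℝ≥0∞) z.1 :=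
          hone.comp (by fun_prop)
        exact h2.mul (h1.mul (by fun_prop))
    _ ≤ ∫⁻ w in Metric.ball (0 : Plane) (2 * r), ENNReal.ofReal (2 * r) ^ 2 * gradSq S g := by
        rw [← lintegral_indicator Metric.isOpen_ball.measurableSet]
        refine lintegral_mono fun w => ?_
        -- The points x for which both ends of the segment from x to x + w lie in the ball; this set
        -- is empty once |w| ≥ 2r.
        have hDo : IsOpen (B ∩ (· + w) ⁻¹' B) :=
          Metric.isOpen_ball.inter (Metric.isOpen_ball.preimage (by fun_prop))
        have heq : ∫⁻ x, B.indicator 1 x * (B.indicator 1 (x + w) * ‖u (x + w) - u x‖ₑ ^ 2) =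
            ∫⁻ x in B ∩ (· + w) ⁻¹' B, ‖u (x + w) - u x‖ₑ ^ 2 := by
          rw [← lintegral_indicator hDo.measurableSet]
          refine lintegral_congr fun x => ?_
          by_cases h1 : x ∈ B <;> by_cases h2 : x + w ∈ B <;> simp [h1, h2]
        rw [heq]
        by_cases hw : w ∈ Metric.ball (0 : Plane) (2 * r)
        · rw [indicator_of_mem hw]
          have hseg : ∀ x ∈ B ∩ (· + w) ⁻¹' B, ∀ t ∈ Icc (0 : ℝ) 1, x + t • w ∈ S :=
            fun x hx t ht => hpS ((convex_ball p r).add_smul_mem hx.1 hx.2 ht)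
          have hwr : ‖w‖ₑ ≤ ENNReal.ofReal (2 * r) := by
            rw [← ofReal_norm]
            exact ENNReal.ofReal_le_ofReal (mem_ball_zero_iff.1 hw).le
          have := lintegral_sq_translate_sub_le hS hDo hseg hu.memLp hSb
            hu.memLp_grad hu.hasWeakPartial
          exact this.trans (mul_le_mul_left (pow_le_pow_left' hwr 2) _)
        · have : B ∩ (· + w) ⁻¹' B = ∅ := by
            refine eq_empty_of_forall_notMem fun x hx => hw ?_
            have h1 := Metric.mem_ball.1 hx.1
            have h2 : dist (x + w) p < r := Metric.mem_ball.1 hx.2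
            rw [mem_ball_zero_iff, show w = (x + w) - x by abel, ← dist_eq_norm]
            linarith [dist_triangle_right (x + w) x p]
          rw [this, setLIntegral_empty]
          exact bot_le
    _ = K * gradSq S g := by
        rw [setLIntegral_const, hK]
        ring

/-- A Poincaré inequality propagates along a translation. -/
lemma of_translate (hS : IsOpen S) (hSb : volume S ≠ ⊤) (hU : IsOpen U) {w : Plane}
    (hUS : ∀ x ∈ U, ∀ t ∈ Icc (0 : ℝ) 1, x + t • w ∈ S) (hUV : ∀ x ∈ U, x + w ∈ V)
    (hV : MeasurableSet V) (h : PoincareOn S V) : PoincareOn S U := by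
  obtain ⟨C, hC, h⟩ := h
  refine ⟨2 * ‖w‖ₑ ^ 2 + 2 * C, by finiteness, fun u g hum hu => ?_⟩
  obtain ⟨c, hc⟩ := h u g hum hu
  refine ⟨c, ?_⟩
  calc ∫⁻ x in U, ‖u x - c‖ₑ ^ 2
      ≤ ∫⁻ x in U, (2 * ‖u (x + w) - u x‖ₑ ^ 2 + 2 * ‖u (x + w) - c‖ₑ ^ 2) := by
        refine lintegral_mono fun x => ?_
        rw [← enorm_neg (u (x + w) - u x), neg_sub]
        exact enorm_sub_sq_le _ _ _
    _ = 2 * (∫⁻ x in U, ‖u (x + w) - u x‖ₑ ^ 2) + 2 * ∫⁻ x in U, ‖u (x + w) - c‖ₑ ^ 2 := by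
        rw [lintegral_add_left (by fun_prop), lintegral_const_mul _ (by fun_prop),
          lintegral_const_mul _ (by fun_prop)]
    _ ≤ 2 * (‖w‖ₑ ^ 2 * gradSq S g) + 2 * (C * gradSq S g) := by
        gcongr
        · exact lintegral_sq_translate_sub_le hS hU hUS hu.memLp hSb hu.memLp_grad
            hu.hasWeakPartial
        · refine le_trans ?_ hc
          rw [← lintegral_indicator hU.measurableSet, ← lintegral_indicator hV,
            ← lintegral_add_right_eq_self (V.indicator _) w]
          refine lintegral_mono fun x => ?_
          by_cases hx : x ∈ U
          · simp [hx, hUV x hx]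
          · simp [hx]
    _ = _ := by ring

/-- The constants c and d of the two pieces are compared on the overlap: its positive measure bounds
|d - c|² by the energy, and then c serves on both pieces. -/
lemma union (hV : volume V ≠ ⊤) (hUV : volume (U ∩ V) ≠ 0) (h1 : PoincareOn S U) (h2 : PoincareOn S V) :
    PoincareOn S (U ∪ V) := by
  obtain ⟨C₁, hC₁, h1⟩ := h1
  obtain ⟨C₂, hC₂, h2⟩ := h2
  set m := volume (U ∩ V)
  have hm : m ≠ ⊤ := ne_top_of_le_ne_top hV (measure_mono inter_subset_right)
  have hmi : m⁻¹ ≠ ⊤ := by simpa using hUV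
  refine ⟨C₁ + (2 * C₂ + 2 * (m⁻¹ * (2 * C₁ + 2 * C₂) * volume V)), by finiteness,
    fun u g hum hu => ?_⟩
  obtain ⟨c, hc⟩ := h1 u g hum hu
  obtain ⟨d, hd⟩ := h2 u g hum hu
  refine ⟨c, ?_⟩
  set A := gradSq S g
  have hdc : ‖d - c‖ₑ ^ 2 ≤ m⁻¹ * ((2 * C₁ + 2 * C₂) * A) := by
    rw [← ENNReal.mul_le_iff_le_inv hUV hm]
    calc m * ‖d - c‖ₑ ^ 2 = ∫⁻ x in U ∩ V, ‖d - c‖ₑ ^ 2 := by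
          rw [setLIntegral_const, mul_comm]
      _ ≤ ∫⁻ x in U ∩ V, (2 * ‖u x - d‖ₑ ^ 2 + 2 * ‖u x - c‖ₑ ^ 2) := by
          refine lintegral_mono fun x => ?_
          rw [← enorm_neg (u x - d), neg_sub]
          exact enorm_sub_sq_le _ _ _
      _ = 2 * (∫⁻ x in U ∩ V, ‖u x - d‖ₑ ^ 2) + 2 * ∫⁻ x in U ∩ V, ‖u x - c‖ₑ ^ 2 := by
          rw [lintegral_add_left (by fun_prop), lintegral_const_mul _ (by fun_prop),
            lintegral_const_mul _ (by fun_prop)]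
      _ ≤ 2 * (C₂ * A) + 2 * (C₁ * A) := by
          gcongr
          · exact (lintegral_mono_set inter_subset_right).trans hd
          · exact (lintegral_mono_set inter_subset_left).trans hc
      _ = _ := by ring
  calc ∫⁻ x in U ∪ V, ‖u x - c‖ₑ ^ 2
      ≤ (∫⁻ x in U, ‖u x - c‖ₑ ^ 2) + ∫⁻ x in V, ‖u x - c‖ₑ ^ 2 := lintegral_union_le _ _ _
    _ ≤ C₁ * A + ∫⁻ x in V, (2 * ‖u x - d‖ₑ ^ 2 + 2 * ‖d - c‖ₑ ^ 2) := by
        gcongr with x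
        exact enorm_sub_sq_le _ _ _
    _ = C₁ * A + (2 * (∫⁻ x in V, ‖u x - d‖ₑ ^ 2) + 2 * (‖d - c‖ₑ ^ 2 * volume V)) := by
        rw [lintegral_add_left (by fun_prop), lintegral_const_mul _ (by fun_prop),
          lintegral_const_mul _ (by fun_prop), setLIntegral_const]
    _ ≤ C₁ * A + (2 * (C₂ * A) + 2 * (m⁻¹ * ((2 * C₁ + 2 * C₂) * A) * volume V)) := by gcongr
    _ = _ := by ring

/-- Poincaré inequalities on the members of a finite open cover of a connected set glue. -/
lemma of_finite_cover (hSb : volume S ≠ ⊤) (hSc : IsConnected S) {ι : Type*} {t : Finset ι}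
    {O : ι → Set Plane} (hO : ∀ i ∈ t, IsOpen (O i)) (hOS : ∀ i ∈ t, O i ⊆ S)
    (hne : ∀ i ∈ t, (O i).Nonempty)
    (hcover : S ⊆ ⋃ i ∈ t, O i) (h : ∀ i ∈ t, PoincareOn S (O i)) : PoincareOn S S := by
  classical
  obtain ⟨x₀, hx₀⟩ := hSc.nonempty
  obtain ⟨i₀, hi₀, -⟩ := mem_iUnion₂.1 (hcover hx₀)
  let W : Finset ι → Set Plane := fun J => ⋃ i ∈ J, O i
  let F : Finset (Finset ι) := t.powerset.filter fun J => J.Nonempty ∧ PoincareOn S (W J)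
  have hF : F.Nonempty := ⟨{i₀}, by simpa [F, W, hi₀] using h i₀ hi₀⟩
  -- Take a largest subfamily whose union satisfies the inequality. If it is not everything,
  -- connectedness makes it meet a remaining member, and `union` contradicts maximality.
  obtain ⟨J, hJF, hmax⟩ := F.exists_max_image Finset.card hF
  obtain ⟨hJt, hJne, hJ⟩ : J ⊆ t ∧ J.Nonempty ∧ PoincareOn S (W J) := by simpa [F] using hJF
  have hWo : ∀ K ⊆ t, IsOpen (W K) := fun K hK => isOpen_biUnion fun i hi => hO i (hK hi)
  have hWn : ∀ K ⊆ t, K.Nonempty → (S ∩ W K).Nonempty := by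
    rintro K hK ⟨i, hi⟩
    obtain ⟨x, hx⟩ := hne i (hK hi)
    exact ⟨x, hOS i (hK hi) hx, mem_iUnion₂.2 ⟨i, hi, hx⟩⟩
  rcases (t \ J).eq_empty_or_nonempty with hemp | hrest
  · have : t ⊆ J := Finset.sdiff_eq_empty_iff_subset.1 hemp
    exact hJ.mono (hcover.trans (biUnion_subset_biUnion_left this))
  · have hsub : t \ J ⊆ t := Finset.sdiff_subset
    obtain ⟨x, -, hx1, hx2⟩ := hSc.isPreconnected _ _ (hWo J hJt) (hWo _ hsub) (by
      intro x hx
      obtain ⟨i, hi, hxi⟩ := mem_iUnion₂.1 (hcover hx)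
      by_cases hiJ : i ∈ J
      · exact .inl (mem_iUnion₂.2 ⟨i, hiJ, hxi⟩)
      · exact .inr (mem_iUnion₂.2 ⟨i, by simp [hi, hiJ], hxi⟩)) (hWn J hJt hJne) (hWn _ hsub hrest)
    obtain ⟨i, hi, hxi⟩ := mem_iUnion₂.1 hx2
    obtain ⟨hit, hiJ⟩ := Finset.mem_sdiff.1 hi
    have hnew : PoincareOn S (O i ∪ W J) := by
      refine union ?_ ?_ (h i hit) hJ
      · exact ne_top_of_le_ne_top hSb (measure_mono (iUnion₂_subset fun i hi => hOS i (hJt hi)))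
      · exact (((hO i hit).inter (hWo J hJt)).measure_pos _ ⟨x, hxi, hx1⟩).ne'
    have hmem : insert i J ∈ F := by
      have : W (insert i J) = O i ∪ W J := Finset.set_biUnion_insert i J O
      simp only [F, Finset.mem_filter, Finset.mem_powerset, this]
      exact ⟨Finset.insert_subset hit hJt, Finset.insert_nonempty _ _, hnew⟩
    have := hmax _ hmem
    rw [Finset.card_insert_of_notMem hiJ] at this
    omega

end PoincareOn

/-- Near a boundary point, the domain can be translated into its interior. -/
lemma exists_poincareOn_inter_ball (hS : IsOpen S) (hSb : volume S ≠ ⊤)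
    (hbd : HasSmoothBoundary S) {p : Plane} (hp : p ∈ closure S) :
    ∃ ρ > 0, PoincareOn S (S ∩ Metric.ball p ρ) := by
  by_cases hpS : p ∈ S
  · obtain ⟨ρ, hρ, hball⟩ := Metric.isOpen_iff.1 hS p hpS
    exact ⟨ρ, hρ, (PoincareOn.ball hS hSb hρ hball).mono inter_subset_right⟩
  obtain ⟨e, γ, r, hγ, hr, hgraph⟩ := hbd p ⟨hp, by rwa [hS.interior_eq]⟩
  -- The direction pointing into S along the vertical axis of the graph coordinates.
  set v : Plane := e.symm (basisVec 1) with hv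
  have hev : e v = basisVec 1 := by simp [hv]
  have hvn : ‖v‖ = 1 := by simp [hv]
  have hmove : ∀ x (s : ℝ), e (x + s • v) 0 = e x 0 ∧ e (x + s • v) 1 = e x 1 + s := by
    intro x s
    rw [map_add, map_smul, hev]
    simp
  have hpγ : γ (e p 0) ≤ e p 1 := by
    have hcl : IsClosed {x : Plane | γ (e x 0) ≤ e x 1} :=
      isClosed_le (hγ.continuous.comp (by fun_prop)) (by fun_prop)
    have hp' : p ∈ closure (S ∩ Metric.ball p r) :=
      Metric.isOpen_ball.closure_inter ⟨hp, Metric.mem_ball_self hr⟩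
    refine closure_minimal (fun x hx => ?_) hcl hp'
    exact ((hgraph x hx.2).1 hx.1).le
  -- Half the radius: points within r/2 of p, moved by at most r/2, stay in the ball where S is a
  -- supergraph.
  set s := r / 2 with hs
  have hwS : p + s • v ∈ S := by
    have hmem : p + s • v ∈ Metric.ball p r := by
      rw [Metric.mem_ball, dist_self_add_left, norm_smul, hvn, Real.norm_of_nonneg (by positivity)]
      linarith
    rw [hgraph _ hmem, (hmove p s).1, (hmove p s).2]
    linarith
  obtain ⟨ρ, hρ, hball⟩ := Metric.isOpen_iff.1 hS _ hwS
  refine ⟨min ρ (r / 2), by positivity, PoincareOn.of_translate hS hSb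
    (hS.inter Metric.isOpen_ball) (w := s • v) ?_ ?_ Metric.isOpen_ball.measurableSet
    (PoincareOn.ball hS hSb hρ hball)⟩
  · rintro x ⟨hxS, hx⟩ t ⟨ht0, ht1⟩
    have hx' : dist x p < r / 2 := (Metric.mem_ball.1 hx).trans_le (min_le_right _ _)
    have hmem : x + t • s • v ∈ Metric.ball p r := by
      have h1 : dist (x + t • s • v) x ≤ r / 2 := by
        rw [dist_self_add_left, norm_smul, norm_smul, hvn, Real.norm_of_nonneg ht0,
          Real.norm_of_nonneg (by positivity)]
        nlinarith
      rw [Metric.mem_ball]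
      linarith [dist_triangle (x + t • s • v) x p]
    have h2 := (hgraph x (by rw [Metric.mem_ball]; linarith)).1 hxS
    rw [hgraph _ hmem, smul_smul, (hmove x _).1, (hmove x _).2]
    have : 0 ≤ t * s := by positivity
    linarith
  · rintro x ⟨-, hx⟩
    rw [Metric.mem_ball, dist_add_right]
    exact (Metric.mem_ball.1 hx).trans_le (min_le_left _ _)

/-- The Poincaré inequality on a bounded connected domain with smooth boundary. -/
lemma poincareOn_self (hS : IsSmoothSimplyConnectedDomain S) : PoincareOn S S := by
  have hSb : volume S ≠ ⊤ := hS.isBounded.measure_lt_top.ne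
  have hSc : IsConnected S := hS.isSimplyConnected.isPathConnected.isConnected
  choose! ρ hρ hP using fun p (hp : p ∈ closure S) =>
    exists_poincareOn_inter_ball hS.isOpen hSb hS.smoothBoundary hp
  obtain ⟨t, ht, hcov⟩ := hS.isBounded.isCompact_closure.elim_nhds_subcover
    (fun p => Metric.ball p (ρ p)) fun p hp => Metric.ball_mem_nhds p (hρ p hp)
  refine PoincareOn.of_finite_cover hSb hSc (t := t) (O := fun p => S ∩ Metric.ball p (ρ p))
    (fun p _ => hS.isOpen.inter Metric.isOpen_ball) (fun p _ => inter_subset_left) ?_ ?_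
    fun p hp => hP p (ht p hp)
  · intro p hp
    obtain ⟨x, hx, hxp⟩ := Metric.mem_closure_iff.1 (ht p hp) (ρ p) (hρ p (ht p hp))
    exact ⟨x, hx, by rwa [Metric.mem_ball, dist_comm]⟩
  · intro x hx
    obtain ⟨p, hp, hxp⟩ := mem_iUnion₂.1 (hcov (subset_closure hx))
    exact mem_iUnion₂.2 ⟨p, hp, hx, hxp⟩

end VonKarman

/-! ### Local Rellich compactness -/

namespace VonKarman

open Filter Topology

variable {S K D : Set Plane}

lemma IsWeakGradient.congr {u u' : Plane → ℝ} {g : Fin 2 → Plane → ℝ} (h : IsWeakGradient S u g)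
    (hu : u =ᵐ[volume.restrict S] u') : IsWeakGradient S u' g :=
  ⟨h.memLp.ae_eq hu, h.memLp_grad, fun i => (h.hasWeakPartial i).congr hu (ae_eq_refl _)⟩

lemma IsWeakGradient.exists_measurable {u : Plane → ℝ} {g : Fin 2 → Plane → ℝ}
    (h : IsWeakGradient S u g) :
    ∃ u', Measurable u' ∧ u =ᵐ[volume.restrict S] u' ∧ IsWeakGradient S u' g :=
  have hm := h.memLp.aestronglyMeasurable
  ⟨hm.mk u, hm.stronglyMeasurable_mk.measurable, hm.ae_eq_mk, h.congr hm.ae_eq_mk⟩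

/-- The integral of `u` over the ball of radius `ε` about `x`. -/
noncomputable def ballIntegral (u : Plane → ℝ) (ε : ℝ) (x : Plane) : ℝ :=
  ∫ w in Metric.ball (0 : Plane) ε, u (x + w)

lemma measurable_ballIntegral {u : Plane → ℝ} (hu : Measurable u) (ε : ℝ) :
    Measurable (ballIntegral u ε) := by
  have : StronglyMeasurable fun z : Plane × Plane => u (z.1 + z.2) :=
    (hu.comp (by fun_prop)).stronglyMeasurable
  exact (this.integral_prod_right (ν := volume.restrict (Metric.ball (0 : Plane) ε))).measurable

lemma ballIntegral_eq {u : Plane → ℝ} {ε : ℝ} {x : Plane} (hx : Metric.ball x ε ⊆ S) :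
    ballIntegral u ε x = ∫ y in S, u y * (Metric.ball x ε).indicator (fun _ => (1 : ℝ)) y := by
  have h1 : ∀ y, u y * (Metric.ball x ε).indicator (fun _ => (1 : ℝ)) y =
      (Metric.ball x ε).indicator u y := fun y => by
    by_cases hy : y ∈ Metric.ball x ε <;> simp [indicator_of_mem, indicator_of_notMem, hy]
  simp_rw [h1]
  rw [setIntegral_eq_integral_of_forall_compl_eq_zero fun y hy =>
    indicator_of_notMem (fun h => hy (hx h)) _, ballIntegral,
    ← integral_indicator Metric.isOpen_ball.measurableSet,
    ← integral_add_left_eq_self ((Metric.ball x ε).indicator u) x]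
  refine integral_congr_ae (.of_forall fun w => ?_)
  simp only [indicator, Metric.mem_ball, dist_self_add_left, dist_zero_right]

lemma memLp_indicator_ball (x : Plane) (ε : ℝ) (μ : Measure Plane) [IsFiniteMeasure μ] :
    MemLp ((Metric.ball x ε).indicator fun _ => (1 : ℝ)) 2 μ :=
  (memLp_const 1).indicator Metric.isOpen_ball.measurableSet

/-- A function is controlled by its oscillation and its averages. -/
lemma enorm_sq_le_oscillation {u : Plane → ℝ} {ε : ℝ} {x : Plane} (hε : 0 < ε)
    (hx : Metric.ball x ε ⊆ S) (hS : MeasurableSet S)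
    (hu : MemLp u 2 (volume.restrict S)) :
    volume (Metric.ball (0 : Plane) ε) * ‖u x‖ₑ ^ 2 ≤
      2 * (∫⁻ w in Metric.ball (0 : Plane) ε, ‖u (x + w) - u x‖ₑ ^ 2) +
      4 * (volume (Metric.ball (0 : Plane) ε))⁻¹ * ‖ballIntegral u ε x‖ₑ ^ 2 := by
  set B := Metric.ball (0 : Plane) ε with hB
  set b := (volume B).toReal with hb
  have hBt : volume B ≠ ⊤ := measure_ball_lt_top.ne
  have hb0 : 0 < b := ENNReal.toReal_pos (Metric.measure_ball_pos _ _ hε).ne' hBt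
  have hbB : volume B = ENNReal.ofReal b := (ENNReal.ofReal_toReal hBt).symm
  have : IsFiniteMeasure (volume.restrict B) := ⟨by simpa using hBt.lt_top⟩
  have hm : MemLp (fun w => u (x + w)) 2 (volume.restrict B) := by
    simp_rw [add_comm x]
    refine memLp_comp_add (fun w hw => hx ?_) hS hu
    simpa [hB, Metric.mem_ball] using hw
  have hm2 : MemLp (fun w => u (x + w) - u x) 2 (volume.restrict B) := hm.sub (memLp_const _)
  have hi : Integrable (fun w => u (x + w)) (volume.restrict B) := hm.integrable (by norm_num)
  have hreal : b * u x ^ 2 ≤ 2 * (∫ w in B, (u (x + w) - u x) ^ 2) +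
      4 * b⁻¹ * ballIntegral u ε x ^ 2 := by
    -- Expand the square and drop the nonnegative term u(x + w)². The cross term integrates to the
    -- ball integral and is absorbed below by completing a square.
    have h1 : ∫ w in B, (u x ^ 2 - 2 * u x * u (x + w)) ≤ ∫ w in B, (u (x + w) - u x) ^ 2 :=
      integral_mono ((integrable_const _).sub (hi.const_mul _)) hm2.integrable_sq
        fun w => by nlinarith [sq_nonneg (u (x + w))]
    rw [integral_sub (integrable_const _) (hi.const_mul _), integral_const_mul,
      setIntegral_const, smul_eq_mul] at h1
    change b * u x ^ 2 - 2 * u x * ballIntegral u ε x ≤ _ at h1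
    set F := ballIntegral u ε x
    have h2 : 4 * u x * F ≤ b * u x ^ 2 + 4 * b⁻¹ * F ^ 2 := by
      have : b * u x ^ 2 + 4 * b⁻¹ * F ^ 2 - 4 * u x * F = b * (u x - 2 * b⁻¹ * F) ^ 2 := by
        field_simp
        ring
      nlinarith [mul_nonneg hb0.le (sq_nonneg (u x - 2 * b⁻¹ * F))]
    linarith
  rw [hm2.lintegral_enorm_sq, enorm_sq_eq_ofReal, enorm_sq_eq_ofReal, hbB,
    ← ENNReal.ofReal_inv_of_pos hb0]
  have := ENNReal.ofReal_le_ofReal hreal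
  rw [ENNReal.ofReal_mul hb0.le, ENNReal.ofReal_add (by positivity) (by positivity),
    ENNReal.ofReal_mul (by norm_num), ENNReal.ofReal_mul (by positivity),
    ENNReal.ofReal_mul (by norm_num)] at this
  simpa using this

/-- Integrates the pointwise splitting over D. After Fubini the oscillation is an integral of
translation differences with |w| < ε, hence is O(ε²) times the energy. -/
lemma lintegral_enorm_sq_le_ballIntegral {u : Plane → ℝ} {g : Fin 2 → Plane → ℝ} {ε : ℝ}
    (hS : IsOpen S) (hSb : volume S ≠ ⊤) (hD : IsOpen D) (hε : 0 < ε)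
    (hDS : ∀ x ∈ D, Metric.ball x ε ⊆ S) (hum : Measurable u) (hu : IsWeakGradient S u g) :
    ∫⁻ x in D, ‖u x‖ₑ ^ 2 ≤ 2 * ENNReal.ofReal ε ^ 2 * gradSq S g +
      4 * (volume (Metric.ball (0 : Plane) ε))⁻¹ ^ 2 * ∫⁻ x in D, ‖ballIntegral u ε x‖ₑ ^ 2 := by
  set B := Metric.ball (0 : Plane) ε with hB
  have hBt : volume B ≠ ⊤ := measure_ball_lt_top.ne
  have hB0 : volume B ≠ 0 := (Metric.measure_ball_pos _ _ hε).ne'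
  have hFm := measurable_ballIntegral hum ε
  have hm2 : Measurable fun z : Plane × Plane => ‖u (z.1 + z.2) - u z.1‖ₑ ^ 2 := by fun_prop
  have hm1 : Measurable fun x => ∫⁻ w in B, ‖u (x + w) - u x‖ₑ ^ 2 :=
    Measurable.lintegral_prod_right' (ν := volume.restrict B)
      (f := fun z : Plane × Plane => ‖u (z.1 + z.2) - u z.1‖ₑ ^ 2) hm2
  have hosc : ∫⁻ x in D, ∫⁻ w in B, ‖u (x + w) - u x‖ₑ ^ 2 ≤
      volume B * (ENNReal.ofReal ε ^ 2 * gradSq S g) := by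
    rw [lintegral_lintegral_swap hm2.aemeasurable, mul_comm, ← setLIntegral_const]
    refine setLIntegral_mono measurable_const fun w hw => ?_
    have hwε : ‖w‖ < ε := mem_ball_zero_iff.1 hw
    have hseg : ∀ x ∈ D, ∀ t ∈ Icc (0 : ℝ) 1, x + t • w ∈ S := fun x hx t ht => hDS x hx <| by
      rw [Metric.mem_ball, dist_self_add_left, norm_smul, Real.norm_of_nonneg ht.1]
      nlinarith [ht.1, ht.2, norm_nonneg w]
    have hwr : ‖w‖ₑ ≤ ENNReal.ofReal ε := by
      rw [← ofReal_norm]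
      exact ENNReal.ofReal_le_ofReal hwε.le
    exact (lintegral_sq_translate_sub_le hS hD hseg hu.memLp hSb hu.memLp_grad
      hu.hasWeakPartial).trans (mul_le_mul_left (pow_le_pow_left' hwr 2) _)
  have key : volume B * ∫⁻ x in D, ‖u x‖ₑ ^ 2 ≤
      volume B * (2 * ENNReal.ofReal ε ^ 2 * gradSq S g +
        4 * (volume B)⁻¹ ^ 2 * ∫⁻ x in D, ‖ballIntegral u ε x‖ₑ ^ 2) := by
    calc volume B * ∫⁻ x in D, ‖u x‖ₑ ^ 2 = ∫⁻ x in D, volume B * ‖u x‖ₑ ^ 2 := by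
          rw [lintegral_const_mul _ (by fun_prop)]
      _ ≤ ∫⁻ x in D, (2 * (∫⁻ w in B, ‖u (x + w) - u x‖ₑ ^ 2) +
            4 * (volume B)⁻¹ * ‖ballIntegral u ε x‖ₑ ^ 2) :=
          setLIntegral_mono ((hm1.const_mul _).add ((hFm.enorm.pow_const 2).const_mul _))
            fun x hx => enorm_sq_le_oscillation hε (hDS x hx) hS.measurableSet hu.memLp
      _ = 2 * (∫⁻ x in D, ∫⁻ w in B, ‖u (x + w) - u x‖ₑ ^ 2) +
            4 * (volume B)⁻¹ * ∫⁻ x in D, ‖ballIntegral u ε x‖ₑ ^ 2 := by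
          rw [lintegral_add_left (hm1.const_mul _), lintegral_const_mul _ hm1,
            lintegral_const_mul _ (hFm.enorm.pow_const 2)]
      _ ≤ 2 * (volume B * (ENNReal.ofReal ε ^ 2 * gradSq S g)) +
            volume B * (volume B)⁻¹ * (4 * (volume B)⁻¹ *
              ∫⁻ x in D, ‖ballIntegral u ε x‖ₑ ^ 2) := by
          rw [ENNReal.mul_inv_cancel hB0 hBt, one_mul]
          gcongr
      _ = _ := by ring
  exact (ENNReal.mul_le_mul_iff_right hB0 hBt).1 key

/-- At each x the ball integral is the pairing of u with a fixed L² indicator, so it tends to zero.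
Cauchy–Schwarz gives a dominating constant. -/
lemma tendsto_lintegral_ballIntegral {u : ℕ → Plane → ℝ} {ε : ℝ} (hSb : volume S ≠ ⊤)
    (hDS : ∀ x ∈ D, Metric.ball x ε ⊆ S) (hD : MeasurableSet D) (hDb : volume D ≠ ⊤)
    (hum : ∀ n, Measurable (u n))
    (hu : ∀ n, MemLp (u n) 2 (volume.restrict S)) {M : ℝ} (hM : ∀ n, ∫ x in S, u n x ^ 2 ≤ M)
    (hweak : ∀ f, MemLp f 2 (volume.restrict S) →
      Tendsto (fun n => ∫ x in S, u n x * f x) atTop (𝓝 0)) :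
    Tendsto (fun n => ∫⁻ x in D, ‖ballIntegral (u n) ε x‖ₑ ^ 2) atTop (𝓝 0) := by
  have : IsFiniteMeasure (volume.restrict S) := ⟨by simpa using hSb.lt_top⟩
  have hlim := tendsto_lintegral_of_dominated_convergence
    (μ := volume.restrict D) (F := fun n x => ‖ballIntegral (u n) ε x‖ₑ ^ 2) (f := fun _ => 0)
    (fun _ => ENNReal.ofReal (M * (volume S).toReal))
    (fun n => (measurable_ballIntegral (hum n) ε).enorm.pow_const 2) ?_ ?_ ?_
  · simpa using hlim
  · intro n
    refine (ae_restrict_iff' hD).2 (.of_forall fun x hx => ?_)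
    change ‖ballIntegral (u n) ε x‖ₑ ^ 2 ≤ _
    rw [enorm_sq_eq_ofReal]
    refine ENNReal.ofReal_le_ofReal ?_
    have hi := memLp_indicator_ball x ε (volume.restrict S)
    rw [ballIntegral_eq (hDS x hx)]
    refine ((hu n).sq_integral_mul_le hi).trans ?_
    have h1 : ∫ y in S, (Metric.ball x ε).indicator (fun _ => (1 : ℝ)) y ^ 2 ≤ ∫ y in S, (1 : ℝ) :=
      integral_mono hi.integrable_sq (integrable_const _) fun y => by
        by_cases hy : y ∈ Metric.ball x ε <;> simp [hy]
    have h2 : ∫ y in S, (1 : ℝ) = (volume S).toReal := by simp [Measure.real]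
    rw [h2] at h1
    exact mul_le_mul (hM n) h1 (integral_nonneg fun y => sq_nonneg _)
      ((integral_nonneg fun y => sq_nonneg _).trans (hM n))
  · rw [setLIntegral_const]
    finiteness
  · refine (ae_restrict_iff' hD).2 (.of_forall fun x hx => ?_)
    have h1 := hweak _ (memLp_indicator_ball x ε (volume.restrict S))
    have h2 := (ENNReal.continuous_pow 2).tendsto _ |>.comp h1.enorm
    simp only [← ballIntegral_eq (hDS x hx)] at h2
    simpa [Function.comp_def] using h2

/-- Rellich's theorem on compact subsets: weak convergence in `L²(S)` with bounded gradients
implies strong convergence on compact subsets. -/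
theorem tendsto_lintegral_sq_of_weak (hS : IsOpen S) (hSb : Bornology.IsBounded S)
    (hK : IsCompact K) (hKS : K ⊆ S) {u : ℕ → Plane → ℝ} {g : ℕ → Fin 2 → Plane → ℝ}
    (hu : ∀ n, IsWeakGradient S (u n) (g n)) {M : ℝ} (hM : ∀ n, ∫ x in S, u n x ^ 2 ≤ M)
    {A : ℝ≥0∞} (hA : A ≠ ⊤) (hgA : ∀ n, gradSq S (g n) ≤ A)
    (hweak : ∀ f, MemLp f 2 (volume.restrict S) →
      Tendsto (fun n => ∫ x in S, u n x * f x) atTop (𝓝 0)) :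
    Tendsto (fun n => ∫⁻ x in K, ‖u n x‖ₑ ^ 2) atTop (𝓝 0) := by
  have hSv : volume S ≠ ⊤ := hSb.measure_lt_top.ne
  choose u' hum huu' hu' using fun n => (hu n).exists_measurable
  have hM' : ∀ n, ∫ x in S, u' n x ^ 2 ≤ M := fun n => by
    have : ∫ x in S, u n x ^ 2 = ∫ x in S, u' n x ^ 2 := integral_congr_ae ((huu' n).pow_const 2)
    exact this ▸ hM n
  have hweak' : ∀ f, MemLp f 2 (volume.restrict S) →
      Tendsto (fun n => ∫ x in S, u' n x * f x) atTop (𝓝 0) := fun f hf => by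
    refine (hweak f hf).congr fun n => ?_
    exact integral_congr_ae ((huu' n).mul (ae_eq_refl f))
  obtain ⟨δ, hδ, hδS⟩ := hK.exists_cthickening_subset_open hS hKS
  set D := Metric.thickening (δ / 2) K with hDdef
  have hD : IsOpen D := Metric.isOpen_thickening
  have hDb : volume D ≠ ⊤ := hK.isBounded.thickening.measure_lt_top.ne
  have hKD : K ⊆ D := Metric.self_subset_thickening (by positivity) K
  have hball : ∀ ε ≤ δ / 2, ∀ x ∈ D, Metric.ball x ε ⊆ S := by
    intro ε hε x hx y hy
    refine hδS (Metric.thickening_subset_cthickening δ K ?_)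
    obtain ⟨z, hz, hxz⟩ := Metric.mem_thickening_iff.1 hx
    refine Metric.mem_thickening_iff.2 ⟨z, hz, ?_⟩
    have := Metric.mem_ball.1 hy
    linarith [dist_triangle y x z]
  rw [ENNReal.tendsto_nhds_zero]
  intro η hη
  have hη2 : 0 < η / 2 := ENNReal.half_pos hη.ne'
  -- The radius ε is fixed first, from the energy bound A alone and hence uniformly in n; then n is
  -- taken large for the averages at that scale.
  have hsmall : Tendsto (fun ε : ℝ => 2 * ENNReal.ofReal ε ^ 2 * A) (𝓝[>] 0) (𝓝 0) := by
    have h1 : Tendsto (fun ε : ℝ => ENNReal.ofReal ε) (𝓝[>] 0) (𝓝 0) := by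
      have := (ENNReal.continuous_ofReal.tendsto 0).mono_left (nhdsWithin_le_nhds (s := Ioi 0))
      simpa using this
    have h2 := (ENNReal.continuous_pow 2).tendsto _ |>.comp h1
    have h3 := ENNReal.Tendsto.mul_const
      (ENNReal.Tendsto.const_mul h2 (a := 2) (.inr (by simp))) (b := A) (.inr hA)
    simpa [Function.comp_def] using h3
  obtain ⟨ε, hεη, hε0, hεδ⟩ := ((hsmall.eventually_le_const hη2).and
    (Ioc_mem_nhdsGT (show (0 : ℝ) < δ / 2 by positivity))).exists
  have hF := tendsto_lintegral_ballIntegral hSv (hball ε hεδ) hD.measurableSet hDb hum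
    (fun n => (hu' n).memLp) hM' hweak'
  have hB0 : volume (Metric.ball (0 : Plane) ε) ≠ 0 := (Metric.measure_ball_pos _ _ hε0).ne'
  have hF2 := ENNReal.Tendsto.const_mul (a := 4 * (volume (Metric.ball (0 : Plane) ε))⁻¹ ^ 2) hF
    (.inr (ENNReal.mul_ne_top (by simp) (ENNReal.pow_ne_top (by simpa using hB0))))
  rw [mul_zero] at hF2
  filter_upwards [hF2.eventually_le_const hη2] with n hn
  calc ∫⁻ x in K, ‖u n x‖ₑ ^ 2 = ∫⁻ x in K, ‖u' n x‖ₑ ^ 2 := by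
        refine lintegral_congr_ae ?_
        filter_upwards [ae_mono (Measure.restrict_mono_set volume hKS) (huu' n)] with x hx
        rw [hx]
    _ ≤ ∫⁻ x in D, ‖u' n x‖ₑ ^ 2 := lintegral_mono_set hKD
    _ ≤ _ := lintegral_enorm_sq_le_ballIntegral hS hSv hD hε0 (hball ε hεδ) (hum n) (hu' n)
    _ ≤ η / 2 + η / 2 := by
        refine add_le_add (le_trans ?_ hεη) hn
        gcongr
        exact hgA n
    _ = η := ENNReal.add_halves η

end VonKarman

/-! ### The Jacobian as a divergence -/

namespace VonKarman

open Filter Topology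

variable {S K : Set Plane} {φ : Plane → ℝ}

/-- Correlations of `L²` functions are continuous. -/
lemma continuous_integral_mul_translate {f h : Plane → ℝ} (hf : MemLp f 2 volume)
    (hh : MemLp h 2 volume) : Continuous fun z => ∫ x, f x * h (x - z) := by
  have hmp : ∀ z : Plane, MeasurePreserving (fun x : Plane => x - z) volume volume :=
    fun z => measurePreserving_sub_right volume z
  -- Translation acts continuously on L².
  have h1 : Continuous fun z : Plane => Lp.compMeasurePreserving
      ((ContinuousMap.mk (fun p : Plane × Plane => p.2 - p.1) (by fun_prop)).curry z) (hmp z)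
      (hh.toLp h) :=
    Continuous.compMeasurePreservingLp continuous_const (ContinuousMap.continuous _) hmp (by simp)
  have h2 := (continuous_const (y := hf.toLp f)).inner (𝕜 := ℝ) h1
  refine h2.congr fun z => ?_
  have h3 := hh.comp_measurePreserving (hmp z)
  have h4 : Lp.compMeasurePreserving
      ((ContinuousMap.mk (fun p : Plane × Plane => p.2 - p.1) (by fun_prop)).curry z) (hmp z)
      (hh.toLp h) = h3.toLp (fun x => h (x - z)) := Lp.toLp_compMeasurePreserving hh (hmp z)
  rw [h4]
  exact hf.inner_toLp_eq h3

/-- Fubini for correlations against a test function. -/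
lemma integral_test_mul_correlation {T : Set Plane} (hφ : IsTestFunction T φ) {f h : Plane → ℝ}
    (hf : MemLp f 2 volume) (hh : MemLp h 2 volume) :
    ∫ z, φ z * ∫ x, f x * h (x - z) = ∫ x, f x * ∫ y, φ (x - y) * h y := by
  have hmp : ∀ z : Plane, MeasurePreserving (fun x : Plane => x - z) volume volume :=
    fun z => measurePreserving_sub_right volume z
  have hmeas : AEStronglyMeasurable (fun p : Plane × Plane => φ p.1 * (f p.2 * h (p.2 - p.1)))
      (volume.prod volume) := by
    have h1 : AEStronglyMeasurable (fun p : Plane × Plane => h (p.2 - p.1))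
        (volume.prod volume) :=
      (hh.1.comp_quasiMeasurePreserving
        (quasiMeasurePreserving_sub_of_right_invariant volume volume)).prod_swap
    exact hφ.continuous.aestronglyMeasurable.comp_fst.mul (hf.1.comp_snd.mul h1)
  have hint : Integrable (fun p : Plane × Plane => φ p.1 * (f p.2 * h (p.2 - p.1)))
      (volume.prod volume) := by
    rw [integrable_prod_iff hmeas]
    constructor
    · exact .of_forall fun z =>
        (hf.integrable_mul (hh.comp_measurePreserving (hmp z))).const_mul (φ z)
    -- The iterated integral of the norm is again a correlation, that of |f| and |h|; it is
    -- continuous and is cut off by φ.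
    · have hc : Continuous fun z => ‖φ z‖ * ∫ x, ‖f x‖ * ‖h (x - z)‖ :=
        hφ.continuous.norm.mul (continuous_integral_mul_translate hf.norm hh.norm)
      refine (hc.integrable_of_hasCompactSupport (hφ.2.1.norm.mul_right)).congr
        (.of_forall fun z => ?_)
      simp only [norm_mul, integral_const_mul]
  calc ∫ z, φ z * ∫ x, f x * h (x - z) = ∫ z, ∫ x, φ z * (f x * h (x - z)) := by
        simp_rw [integral_const_mul]
    _ = ∫ x, ∫ z, φ z * (f x * h (x - z)) := integral_integral_swap hint
    _ = ∫ x, f x * ∫ y, φ (x - y) * h y := by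
        refine integral_congr_ae (.of_forall fun x => ?_)
        change ∫ z, φ z * (f x * h (x - z)) = f x * ∫ y, φ (x - y) * h y
        rw [← integral_const_mul, ← integral_sub_left_eq_self _ volume x]
        refine integral_congr_ae (.of_forall fun y => ?_)
        simp only [sub_sub_cancel]
        ring

lemma fderiv_comp_const_sub_apply (hφ : ContDiff ℝ ∞ φ) (x y v : Plane) :
    fderiv ℝ (fun y => φ (x - y)) y v = -fderiv ℝ φ (x - y) v := by
  have h1 : HasFDerivAt (fun y : Plane => x - y) (-ContinuousLinearMap.id ℝ Plane) y :=
    (hasFDerivAt_id y).const_sub x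
  have h2 : HasFDerivAt φ (fderiv ℝ φ (x - y)) (x - y) :=
    (hφ.differentiable (by simp) _).hasFDerivAt
  have h3 : HasFDerivAt (fun y => φ (x - y))
      ((fderiv ℝ φ (x - y)).comp (-ContinuousLinearMap.id ℝ Plane)) y := h2.comp y h1
  rw [h3.fderiv]
  simp

lemma fderiv_fderiv_apply_comm (hφ : ContDiff ℝ ∞ φ) (x v w : Plane) :
    fderiv ℝ (fun x => fderiv ℝ φ x v) x w = fderiv ℝ (fun x => fderiv ℝ φ x w) x v := by
  have hd : DifferentiableAt ℝ (fderiv ℝ φ) x :=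
    (hφ.fderiv_right (m := ∞) (by simp)).differentiable (by simp) x
  have h : ∀ a b : Plane, fderiv ℝ (fun x => fderiv ℝ φ x a) x b =
      fderiv ℝ (fderiv ℝ φ) x b a := fun a b => by
    rw [fderiv_clm_apply hd (differentiableAt_const a)]
    simp
  rw [h, h]
  exact (hφ.contDiffAt.isSymmSndFDerivAt (by
    rw [minSmoothness_of_isRCLikeNormedField]; exact WithTop.coe_le_coe.2 le_top)).eq w v

/-- A weak gradient is curl free. -/
lemma IsWeakGradient.integral_curl_eq_zero {g : Plane → ℝ} {q : Fin 2 → Plane → ℝ}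
    (h : IsWeakGradient S g q) (hφ : IsTestFunction S φ) :
    ∫ x in S, (q 1 x * fderiv ℝ φ x (basisVec 0) - q 0 x * fderiv ℝ φ x (basisVec 1)) = 0 := by
  have h0 := hφ.fderiv_apply (basisVec 0)
  have h1 := hφ.fderiv_apply (basisVec 1)
  have e0 := (h.hasWeakPartial 0).2.2 _ h1
  have e1 := (h.hasWeakPartial 1).2.2 _ h0
  simp only [fderiv_fderiv_apply_comm hφ.1 _ (basisVec 1)] at e0
  rw [integral_sub (h0.integrable_mul_of_memLp (h.memLp_grad 1))
    (h1.integrable_mul_of_memLp (h.memLp_grad 0))]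
  have : ∫ x in S, g x * fderiv ℝ (fun x => fderiv ℝ φ x (basisVec 0)) x (basisVec 1) =
      -∫ x in S, q 0 x * fderiv ℝ φ x (basisVec 1) := e0
  rw [e1] at this
  linarith

lemma integrable_mul_mul_comp_sub {f h : Plane → ℝ} (hf : Integrable f) (hh : Integrable h)
    {T : Set Plane} (hφ : IsTestFunction T φ) :
    Integrable (fun p : Plane × Plane => f p.1 * (φ (p.1 - p.2) * h p.2))
      (volume.prod volume) := by
  obtain ⟨C, hC⟩ := hφ.exists_bound
  have hc : Continuous fun p : Plane × Plane => φ (p.1 - p.2) := hφ.continuous.comp (by fun_prop)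
  refine ((hf.mul_prod hh).mul_bdd (c := C) hc.aestronglyMeasurable
    (.of_forall fun p => hC _)).congr (.of_forall fun p => ?_)
  ring

/-- The curl of a weak gradient vanishes also against compactly supported Sobolev functions. -/
lemma IsWeakGradient.integral_curl_eq_zero_of_compact (hS : IsOpen S) (hSb : volume S ≠ ⊤)
    {g : Plane → ℝ} {q : Fin 2 → Plane → ℝ} (hq : IsWeakGradient S g q)
    (hK : IsCompact K) (hKS : K ⊆ S) {ψ : Plane → ℝ} {p : Fin 2 → Plane → ℝ}
    (hp : IsWeakGradient univ ψ p) (hψK : ∀ x ∉ K, ψ x = 0) :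
    ∫ x in S, (q 1 x * p 0 x - q 0 x * p 1 x) = 0 := by
  have hψ : MemLp ψ 2 volume := by simpa using hp.memLp
  have hpm : ∀ i, MemLp (p i) 2 volume := fun i => by simpa using hp.memLp_grad i
  have hψi : Integrable ψ := by
    have : IsFiniteMeasure (volume.restrict K) := ⟨by simpa using hK.measure_lt_top⟩
    have h1 : IntegrableOn ψ K := (hψ.mono_measure Measure.restrict_le_self).integrable (by norm_num)
    rwa [integrableOn_iff_integrable_of_support_subset] at h1
    exact fun x hx => by_contra fun h => hx (hψK x h)
  set Q : Fin 2 → Plane → ℝ := fun i => S.indicator (q i) with hQdef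
  have hQ : ∀ i, MemLp (Q i) 2 volume := fun i =>
    (memLp_indicator_iff_restrict hS.measurableSet).2 (hq.memLp_grad i)
  have hQi : ∀ i, Integrable (Q i) := fun i => by
    have : IsFiniteMeasure (volume.restrict S) := ⟨by simpa using hSb.lt_top⟩
    have : IntegrableOn (q i) S := (hq.memLp_grad i).integrable (by norm_num)
    exact this.integrable_indicator hS.measurableSet
  -- The curl pairing with ψ translated by z; the claim is J 0 = 0. Since J is continuous, it
  -- suffices that it integrates to zero against every test function ρ near 0. Such an integral
  -- mollifies ψ and reduces to smooth test functions.
  set J : Plane → ℝ := fun z => (∫ x, Q 1 x * p 0 (x - z)) - ∫ x, Q 0 x * p 1 (x - z) with hJdef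
  have hJc : Continuous J := (continuous_integral_mul_translate (hQ 1) (hpm 0)).sub
    (continuous_integral_mul_translate (hQ 0) (hpm 1))
  obtain ⟨δ, hδ, hδS⟩ := hK.exists_cthickening_subset_open hS hKS
  have hJint : ∀ ρ, IsTestFunction (Metric.ball (0 : Plane) δ) ρ →
      ∫ z in Metric.ball (0 : Plane) δ, J z * ρ z = 0 := by
    intro ρ hρ
    have hinner : ∀ (i : Fin 2) x, ∫ y, ρ (x - y) * p i y =
        ∫ y, fderiv ℝ ρ (x - y) (basisVec i) * ψ y := by
      intro i x
      have ht : IsTestFunction univ fun y => ρ (x - y) :=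
        hρ.comp_const_sub x fun _ _ => mem_univ _
      have := (hp.hasWeakPartial i).2.2 _ ht
      simp only [Measure.restrict_univ, fderiv_comp_const_sub_apply hρ.1, mul_neg, integral_neg,
        neg_inj] at this
      simpa only [mul_comm] using this.symm
    have hswap : ∀ i j : Fin 2, ∫ z, ρ z * ∫ x, Q j x * p i (x - z) =
        ∫ y, ψ y * ∫ x in S, q j x * fderiv ℝ (fun x => ρ (x - y)) x (basisVec i) := by
      intro i j
      rw [integral_test_mul_correlation hρ (hQ j) (hpm i)]
      simp_rw [hinner, ← integral_const_mul]
      rw [integral_integral_swap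
        (integrable_mul_mul_comp_sub (hQi j) hψi (hρ.fderiv_apply (basisVec i)))]
      refine integral_congr_ae (.of_forall fun y => ?_)
      change ∫ x, Q j x * (fderiv ℝ ρ (x - y) (basisVec i) * ψ y) = _
      simp only
      rw [← integral_indicator hS.measurableSet]
      refine integral_congr_ae (.of_forall fun x => ?_)
      by_cases hx : x ∈ S
      · simp only [hQdef, indicator_of_mem hx, fderiv_comp_sub]
        ring
      · simp [hQdef, indicator_of_notMem hx]
    have hint : ∀ i j : Fin 2, Integrable fun z => ρ z * ∫ x, Q j x * p i (x - z) := fun i j =>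
      (hρ.continuous.mul (continuous_integral_mul_translate (hQ j)
        (hpm i))).integrable_of_hasCompactSupport hρ.2.1.mul_right
    have hint2 : ∀ i j : Fin 2, Integrable fun y => ψ y *
        ∫ x in S, q j x * fderiv ℝ (fun x => ρ (x - y)) x (basisVec i) := by
      intro i j
      have h1 := (integrable_mul_mul_comp_sub (hQi j) hψi
        (hρ.fderiv_apply (basisVec i))).integral_prod_right
      refine h1.congr (.of_forall fun y => ?_)
      change ∫ x, Q j x * (fderiv ℝ ρ (x - y) (basisVec i) * ψ y) = _
      simp only
      rw [← integral_const_mul, ← integral_indicator hS.measurableSet]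
      refine integral_congr_ae (.of_forall fun x => ?_)
      by_cases hx : x ∈ S
      · simp only [hQdef, indicator_of_mem hx, fderiv_comp_sub]
        ring
      · simp [hQdef, indicator_of_notMem hx]
    rw [hρ.setIntegral_eq]
    have h1 : ∀ z, J z * ρ z = ρ z * (∫ x, Q 1 x * p 0 (x - z)) -
        ρ z * ∫ x, Q 0 x * p 1 (x - z) := fun z => by simp only [hJdef]; ring
    simp_rw [h1]
    rw [integral_sub (hint 0 1) (hint 1 0), hswap, hswap, ← integral_sub (hint2 0 1) (hint2 1 0)]
    -- For y in K, ρ(· - y) is supported in S because ρ lives in the δ-ball, so the curl identity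
    -- for test functions applies; off K, ψ vanishes.
    refine integral_eq_zero_of_ae (.of_forall fun y => ?_)
    by_cases hy : y ∈ K
    · have ht : IsTestFunction S fun x => ρ (x - y) := hρ.comp_sub y fun x hx => by
        refine hδS (Metric.thickening_subset_cthickening δ K
          (Metric.mem_thickening_iff.2 ⟨y, hy, ?_⟩))
        rw [dist_add_self_left]
        simpa using hρ.2.2 hx
      have := hq.integral_curl_eq_zero ht
      rw [integral_sub ((ht.fderiv_apply _).integrable_mul_of_memLp (hq.memLp_grad 1))
        ((ht.fderiv_apply _).integrable_mul_of_memLp (hq.memLp_grad 0))] at this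
      change ψ y * _ - ψ y * _ = 0
      rw [← mul_sub, this, mul_zero]
    · simp [hψK y hy]
  have hJ0 : J 0 = 0 := by
    have hae := ae_eq_zero_of_integral_test Metric.isOpen_ball
      (hJc.locallyIntegrable.locallyIntegrableOn _) hJint
    have := Measure.eqOn_open_of_ae_eq hae Metric.isOpen_ball hJc.continuousOn continuousOn_const
    exact this (Metric.mem_ball_self hδ)
  simp only [hJdef, sub_zero] at hJ0
  have hQp : ∀ i j, Integrable fun x => Q i x * p j x := fun i j => (hQ i).integrable_mul (hpm j)
  rw [← integral_sub (hQp 1 0) (hQp 0 1)] at hJ0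
  rw [← hJ0, ← integral_indicator hS.measurableSet]
  refine integral_congr_ae (.of_forall fun x => ?_)
  by_cases hx : x ∈ S <;> simp [hQdef, hx]

lemma IsTestFunction.memLp_mul (hφ : IsTestFunction S φ) {f : Plane → ℝ}
    (hf : MemLp f 2 (volume.restrict S)) : MemLp (fun x => f x * φ x) 2 (volume.restrict S) :=
  (hφ.memLp ⊤ (volume.restrict S)).mul' hf

lemma IsTestFunction.memLp_mul_volume (hS : IsOpen S) (hφ : IsTestFunction S φ) {f : Plane → ℝ}
    (hf : MemLp f 2 (volume.restrict S)) : MemLp (fun x => f x * φ x) 2 volume := by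
  have h1 := hφ.memLp_mul hf
  rw [← memLp_indicator_iff_restrict hS.measurableSet] at h1
  rwa [indicator_eq_self.2] at h1
  exact fun x hx => by_contra fun h => hx (by simp [hφ.eq_zero_of_notMem h])

/-- Product of a Sobolev function and a test function. -/
lemma IsWeakGradient.mul_test (hS : IsOpen S) {f : Plane → ℝ} {p : Fin 2 → Plane → ℝ}
    (hf : IsWeakGradient S f p) (hφ : IsTestFunction S φ) :
    IsWeakGradient univ (fun x => f x * φ x)
      fun i x => p i x * φ x + f x * fderiv ℝ φ x (basisVec i) := by
  have h1 := hφ.memLp_mul_volume hS hf.memLp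
  have h3 := fun i => hφ.memLp_mul_volume hS (hf.memLp_grad i)
  have h4 := fun i => (hφ.fderiv_apply (basisVec i)).memLp_mul_volume hS hf.memLp
  have h2 : ∀ i, MemLp (fun x => p i x * φ x + f x * fderiv ℝ φ x (basisVec i)) 2 volume :=
    fun i => (h3 i).add (h4 i)
  refine ⟨by simpa using h1, fun i => by simpa using h2 i, fun i =>
    ⟨(h1.locallyIntegrable (by norm_num)).locallyIntegrableOn _,
      ((h2 i).locallyIntegrable (by norm_num)).locallyIntegrableOn _, fun η hη => ?_⟩⟩
  rw [Measure.restrict_univ]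
  have ht : IsTestFunction S fun x => φ x * η x := hφ.mul_contDiff hη.1
  have ht' := (hφ.fderiv_apply (basisVec i)).mul_contDiff hη.1
  have ht'' := hφ.mul_contDiff ((hη.fderiv_apply (basisVec i)).1)
  have hw := (hf.hasWeakPartial i).2.2 _ ht
  have hd : ∀ x, fderiv ℝ (fun x => φ x * η x) x (basisVec i) =
      φ x * fderiv ℝ η x (basisVec i) + fderiv ℝ φ x (basisVec i) * η x := by
    intro x
    rw [fderiv_fun_mul (hφ.1.differentiable (by simp) x) (hη.1.differentiable (by simp) x)]
    simp [mul_comm]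
  have e1 : ∀ x, f x * fderiv ℝ (fun x => φ x * η x) x (basisVec i) =
      f x * (φ x * fderiv ℝ η x (basisVec i)) + f x * (fderiv ℝ φ x (basisVec i) * η x) :=
    fun x => by rw [hd, mul_add]
  have hw' : ∫ x in S, f x * fderiv ℝ (fun x => φ x * η x) x (basisVec i) =
      -∫ x in S, p i x * (φ x * η x) := hw
  simp_rw [e1] at hw'
  rw [integral_add (ht''.integrable_mul_of_memLp hf.memLp) (ht'.integrable_mul_of_memLp hf.memLp),
    ht''.setIntegral_eq, ht'.setIntegral_eq, ht.setIntegral_eq] at hw'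
  have e2 : ∀ x, (p i x * φ x + f x * fderiv ℝ φ x (basisVec i)) * η x =
      p i x * φ x * η x + f x * fderiv ℝ φ x (basisVec i) * η x := fun x => add_mul _ _ _
  change ∫ x, f x * φ x * fderiv ℝ η x (basisVec i) = _
  simp_rw [e2]
  rw [integral_add (hη.integrable_mul_of_memLp (h3 i)) (hη.integrable_mul_of_memLp (h4 i))]
  simp_rw [mul_assoc]
  linarith

/-- The Jacobian determinant is a divergence. -/
lemma IsWeakGradient.integral_jacobian_mul (hS : IsOpen S) (hSb : volume S ≠ ⊤)
    {f g : Plane → ℝ} {p q : Fin 2 → Plane → ℝ} (hf : IsWeakGradient S f p)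
    (hg : IsWeakGradient S g q) (hφ : IsTestFunction S φ) :
    ∫ x in S, (p 0 x * q 1 x - p 1 x * q 0 x) * φ x =
      -∫ x in S, f x * (q 1 x * fderiv ℝ φ x (basisVec 0) - q 0 x * fderiv ℝ φ x (basisVec 1)) := by
  -- The curl identity for ∇g is applied to ψ = fφ; the product rule for ∇(fφ) yields the Jacobian
  -- term and the divergence term.
  have key := hg.integral_curl_eq_zero_of_compact hS hSb hφ.2.1 hφ.2.2 (hf.mul_test hS hφ)
    fun x hx => by rw [image_eq_zero_of_notMem_tsupport hx, mul_zero]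
  have h0 := hφ.fderiv_apply (basisVec 0)
  have h1 := hφ.fderiv_apply (basisVec 1)
  have i1 : Integrable (fun x => (p 0 x * q 1 x - p 1 x * q 0 x) * φ x) (volume.restrict S) := by
    refine (((hg.memLp_grad 1).integrable_mul (hφ.memLp_mul (hf.memLp_grad 0))).sub
      ((hg.memLp_grad 0).integrable_mul (hφ.memLp_mul (hf.memLp_grad 1)))).congr
      (.of_forall fun x => ?_)
    simp only [Pi.sub_apply, Pi.mul_apply]
    ring
  have i2 : Integrable (fun x => f x * (q 1 x * fderiv ℝ φ x (basisVec 0) -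
      q 0 x * fderiv ℝ φ x (basisVec 1))) (volume.restrict S) :=
    hf.memLp.integrable_mul ((h0.memLp_mul (hg.memLp_grad 1)).sub (h1.memLp_mul (hg.memLp_grad 0)))
  rw [eq_neg_iff_add_eq_zero, ← integral_add i1 i2, ← key]
  refine integral_congr_ae (.of_forall fun x => ?_)
  simp only
  ring

end VonKarman

/-! ### Weak compactness and weak limits -/

namespace VonKarman

open Filter Topology

variable {S K : Set Plane} {φ : Plane → ℝ}

/-- Bounded sequences in a separable Hilbert space have weakly convergent subsequences,
simultaneously for finitely many sequences. -/
lemma exists_subseq_tendsto_inner {ι H : Type*} [Fintype ι] [NormedAddCommGroup H]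
    [InnerProductSpace ℝ H] [CompleteSpace H] [SecondCountableTopology H] {u : ι → ℕ → H}
    {C : ℝ} (hC : 0 ≤ C) (hu : ∀ i n, ‖u i n‖ ≤ C) :
    ∃ θ : ℕ → ℕ, StrictMono θ ∧ ∃ U : ι → H, ∀ i y,
      Tendsto (fun n => inner ℝ (u i (θ n)) y) atTop (𝓝 (inner ℝ (U i) y)) := by
  classical
  -- All sequences are packed into one sequence of functionals on the product, so a single use of
  -- Banach–Alaoglu extracts a common subsequence.
  let L : ℕ → StrongDual ℝ (ι → H) := fun n =>
    ∑ i, (innerSL ℝ (u i n)).comp (ContinuousLinearMap.proj i)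
  have hLapply : ∀ n y, L n y = ∑ i, inner ℝ (u i n) (y i) := fun n y => by simp [L]
  have hsingle : ∀ n i (y : H), L n (Pi.single i y) = inner ℝ (u i n) y := by
    intro n i y
    rw [hLapply, Finset.sum_eq_single i]
    · simp
    · intro j _ hj
      simp [hj]
    · simp
  have hL : ∀ n, ‖L n‖ ≤ Fintype.card ι * C := fun n => by
    refine ContinuousLinearMap.opNorm_le_bound _ (by positivity) fun y => ?_
    rw [hLapply]
    calc ‖∑ i, inner ℝ (u i n) (y i)‖ ≤ ∑ i, C * ‖y‖ := norm_sum_le_of_le _ fun i _ =>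
          (norm_inner_le_norm _ _).trans (mul_le_mul (hu i n) (norm_le_pi_norm y i)
            (norm_nonneg _) hC)
      _ = _ := by simp [mul_assoc]
  obtain ⟨Λ, -, θ, hθ, hlim⟩ := WeakDual.isSeqCompact_closedBall ℝ (ι → H) 0
    (Fintype.card ι * C) (x := fun n => StrongDual.toWeakDual (L n)) fun n => by
      simpa using hL n
  refine ⟨θ, hθ, fun i => (InnerProductSpace.toDual ℝ H).symm
    ((WeakDual.toStrongDual Λ).comp (ContinuousLinearMap.single ℝ (fun _ => H) i)), fun i y => ?_⟩
  rw [InnerProductSpace.toDual_symm_apply]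
  have := ((WeakDual.eval_continuous (Pi.single i y : ι → H)).tendsto Λ).comp hlim
  refine this.congr fun n => ?_
  exact hsingle (θ n) i y

/-- Weak sequential compactness in `L²(S)` for finitely many bounded sequences. -/
lemma exists_subseq_tendsto_integral {ι : Type*} [Fintype ι] {u : ι → ℕ → Plane → ℝ} {C : ℝ}
    (hum : ∀ i n, MemLp (u i n) 2 (volume.restrict S))
    (hu : ∀ i n, ∫ x in S, u i n x ^ 2 ≤ C) :
    ∃ θ : ℕ → ℕ, StrictMono θ ∧ ∃ U : ι → Plane → ℝ, (∀ i, MemLp (U i) 2 (volume.restrict S)) ∧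
      ∀ i f, MemLp f 2 (volume.restrict S) →
        Tendsto (fun n => ∫ x in S, u i (θ n) x * f x) atTop (𝓝 (∫ x in S, U i x * f x)) := by
  have : Fact ((2 : ℝ≥0∞) ≠ ⊤) := ⟨by simp⟩
  obtain ⟨θ, hθ, U, hU⟩ := exists_subseq_tendsto_inner (u := fun i n => (hum i n).toLp (u i n))
    (Real.sqrt_nonneg C) fun i n => Real.le_sqrt_of_sq_le ((hum i n).norm_toLp_sq.trans_le (hu i n))
  refine ⟨θ, hθ, fun i => U i, fun i => Lp.memLp (U i), fun i f hf => ?_⟩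
  have := hU i (hf.toLp f)
  simp_rw [(hum _ _).inner_toLp_eq hf] at this
  rwa [← Lp.toLp_coeFn (U i) (Lp.memLp (U i)), (Lp.memLp (U i)).inner_toLp_eq hf] at this

/-- Product of a strongly and a weakly convergent sequence. -/
lemma tendsto_integral_mul_mul_test {χ : Plane → ℝ} (hχ : IsTestFunction S χ)
    {a b : ℕ → Plane → ℝ} {A B : Plane → ℝ} {C : ℝ}
    (ha : ∀ n, MemLp (a n) 2 (volume.restrict S)) (hA : MemLp A 2 (volume.restrict S))
    (hb : ∀ n, MemLp (b n) 2 (volume.restrict S)) (hbC : ∀ n, ∫ x in S, b n x ^ 2 ≤ C)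
    (hstrong : Tendsto (fun n => ∫⁻ x in tsupport χ, ‖a n x - A x‖ₑ ^ 2) atTop (𝓝 0))
    (hweak : ∀ f, MemLp f 2 (volume.restrict S) →
      Tendsto (fun n => ∫ x in S, b n x * f x) atTop (𝓝 (∫ x in S, B x * f x))) :
    Tendsto (fun n => ∫ x in S, a n x * (b n x * χ x)) atTop
      (𝓝 (∫ x in S, A x * (B x * χ x))) := by
  obtain ⟨M, hM⟩ := hχ.exists_bound
  have hd : ∀ n, MemLp (fun x => a n x - A x) 2 (volume.restrict S) := fun n => (ha n).sub hA
  have hdχ : ∀ n, MemLp (fun x => (a n x - A x) * χ x) 2 (volume.restrict S) :=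
    fun n => hχ.memLp_mul (hd n)
  have hs : Tendsto (fun n => ∫ x in S, ((a n x - A x) * χ x) ^ 2) atTop (𝓝 0) := by
    have h1 := (ENNReal.tendsto_toReal ENNReal.zero_ne_top).comp hstrong
    have h2 : Tendsto (fun n => M ^ 2 * ∫ x in tsupport χ, (a n x - A x) ^ 2) atTop (𝓝 0) := by
      have h3 := h1.const_mul (M ^ 2)
      rw [ENNReal.toReal_zero, mul_zero] at h3
      refine h3.congr fun n => ?_
      have h4 := (hd n).mono_measure (Measure.restrict_mono_set volume hχ.2.2)
      simp only [Function.comp_apply]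
      rw [h4.lintegral_enorm_sq, ENNReal.toReal_ofReal (integral_nonneg fun x => sq_nonneg _)]
    refine squeeze_zero (fun n => integral_nonneg fun x => sq_nonneg _) (fun n => ?_) h2
    have h4 := (hd n).mono_measure (Measure.restrict_mono_set volume hχ.2.2)
    have h5 : ∫ x in S, ((a n x - A x) * χ x) ^ 2 =
        ∫ x in tsupport χ, ((a n x - A x) * χ x) ^ 2 := by
      rw [setIntegral_eq_integral_of_forall_compl_eq_zero fun x hx => by
          rw [hχ.eq_zero_of_notMem hx]; simp,
        setIntegral_eq_integral_of_forall_compl_eq_zero fun x hx => by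
          rw [image_eq_zero_of_notMem_tsupport hx]; simp]
    rw [h5, ← integral_const_mul]
    refine integral_mono ((hdχ n).mono_measure
      (Measure.restrict_mono_set volume hχ.2.2)).integrable_sq (h4.integrable_sq.const_mul _)
      fun x => ?_
    have : χ x ^ 2 ≤ M ^ 2 := by rw [← sq_abs]; gcongr; exact hM x
    nlinarith [sq_nonneg (a n x - A x)]
  -- Write a b = (a - A) b + A b: the first term vanishes by Cauchy–Schwarz with b bounded, the
  -- second converges by weak convergence tested against Aχ.
  have hcross : Tendsto (fun n => ∫ x in S, (a n x - A x) * χ x * b n x) atTop (𝓝 0) := by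
    have h1 : Tendsto (fun n => √((∫ x in S, ((a n x - A x) * χ x) ^ 2) * C)) atTop (𝓝 0) := by
      have := (hs.mul_const C).sqrt
      simpa using this
    refine squeeze_zero_norm (fun n => ?_) h1
    rw [Real.norm_eq_abs]
    refine Real.abs_le_sqrt (((hdχ n).sq_integral_mul_le (hb n)).trans ?_)
    exact mul_le_mul_of_nonneg_left (hbC n) (integral_nonneg fun x => sq_nonneg _)
  have hmain := hweak _ (hχ.memLp_mul hA)
  have := hcross.add hmain
  rw [zero_add] at this
  refine (this.congr fun n => ?_).trans_eq ?_
  · have i1 : Integrable (fun x => (a n x - A x) * χ x * b n x) (volume.restrict S) :=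
      (hdχ n).integrable_mul (hb n)
    have i2 : Integrable (fun x => b n x * (A x * χ x)) (volume.restrict S) :=
      (hb n).integrable_mul (hχ.memLp_mul hA)
    rw [← integral_add i1 i2]
    refine integral_congr_ae (.of_forall fun x => ?_)
    simp only
    ring
  · congr 1
    refine integral_congr_ae (.of_forall fun x => ?_)
    simp only
    ring

/-- Both sides of the defining identity are pairings with fixed L² functions, so they pass to weak
limits. -/
lemma HasWeakPartial.of_tendsto {i : Fin 2} {u g : ℕ → Plane → ℝ}
    {U G : Plane → ℝ} (h : ∀ n, HasWeakPartial S i (u n) (g n))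
    (hU : MemLp U 2 (volume.restrict S)) (hG : MemLp G 2 (volume.restrict S))
    (hu : ∀ f, MemLp f 2 (volume.restrict S) →
      Tendsto (fun n => ∫ x in S, u n x * f x) atTop (𝓝 (∫ x in S, U x * f x)))
    (hg : ∀ f, MemLp f 2 (volume.restrict S) →
      Tendsto (fun n => ∫ x in S, g n x * f x) atTop (𝓝 (∫ x in S, G x * f x))) :
    HasWeakPartial S i U G := by
  refine ⟨locallyIntegrableOn_of_locallyIntegrable_restrict (hU.locallyIntegrable (by norm_num)),
    locallyIntegrableOn_of_locallyIntegrable_restrict (hG.locallyIntegrable (by norm_num)),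
    fun φ hφ => ?_⟩
  have h1 := hu _ ((hφ.fderiv_apply (basisVec i)).memLp 2 _)
  have h2 := (hg _ (hφ.memLp 2 _)).neg
  exact tendsto_nhds_unique h1 (h2.congr fun n => ((h n).2.2 φ hφ).symm)

namespace IsWeakGradient

variable {u u' : Plane → ℝ} {g g' : Fin 2 → Plane → ℝ}

lemma sub (h : IsWeakGradient S u g) (h' : IsWeakGradient S u' g') :
    IsWeakGradient S (fun x => u x - u' x) fun i x => g i x - g' i x := by
  refine ⟨h.memLp.sub h'.memLp, fun i => (h.memLp_grad i).sub (h'.memLp_grad i), fun i =>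
    ⟨(h.hasWeakPartial i).1.sub (h'.hasWeakPartial i).1,
      (h.hasWeakPartial i).2.1.sub (h'.hasWeakPartial i).2.1, fun φ hφ => ?_⟩⟩
  have hd := hφ.fderiv_apply (basisVec i)
  have h1 := (h.hasWeakPartial i).2.2 φ hφ
  have h2 := (h'.hasWeakPartial i).2.2 φ hφ
  simp only [sub_mul]
  rw [integral_sub (hφ.integrable_mul_of_memLp (h.memLp_grad i))
    (hφ.integrable_mul_of_memLp (h'.memLp_grad i)),
    integral_sub (hd.integrable_mul_of_memLp h.memLp) (hd.integrable_mul_of_memLp h'.memLp),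
    h1, h2]
  ring

/-- Classical gradients of affine functions are weak gradients. -/
lemma affine (hSb : Bornology.IsBounded S) (hS : IsOpen S) (d : ℝ) (c : Fin 2 → ℝ) :
    IsWeakGradient S (fun x => (∑ i, c i * x i) + d) fun i _ => c i := by
  have : IsFiniteMeasure (volume.restrict S) := ⟨by simpa using hSb.measure_lt_top⟩
  have hcont : Continuous fun x : Plane => (∑ i, c i * x i) + d := by fun_prop
  obtain ⟨M, hM⟩ := hSb.isCompact_closure.exists_bound_of_continuousOn hcont.continuousOn
  have hmem : MemLp (fun x : Plane => (∑ i, c i * x i) + d) 2 (volume.restrict S) :=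
    MemLp.of_bound hcont.aestronglyMeasurable M
      ((ae_restrict_iff' hS.measurableSet).2 (.of_forall fun x hx => hM x (subset_closure hx)))
  refine ⟨hmem, fun i => memLp_const _, fun i => ⟨hcont.locallyIntegrable.locallyIntegrableOn _,
    continuous_const.locallyIntegrable.locallyIntegrableOn _, fun φ hφ => ?_⟩⟩
  have hd := hφ.fderiv_apply (basisVec i)
  have hdiff : Differentiable ℝ fun x : Plane => (∑ i, c i * x i) + d := by fun_prop
  have hfd : ∀ x, fderiv ℝ (fun x : Plane => (∑ i, c i * x i) + d) x (basisVec i) = c i := by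
    intro x
    have h1 : HasFDerivAt (fun x : Plane => (∑ i, c i * x i) + d)
        (∑ i, c i • (EuclideanSpace.proj i : Plane →L[ℝ] ℝ)) x := by
      refine HasFDerivAt.add_const d (HasFDerivAt.fun_sum fun i _ => ?_)
      exact (EuclideanSpace.proj i : Plane →L[ℝ] ℝ).hasFDerivAt.const_mul (c i)
    rw [h1.fderiv]
    fin_cases i <;> simp [Fin.sum_univ_two]
  have key := integral_mul_fderiv_eq_neg_fderiv_mul_of_integrable (μ := volume) (v := basisVec i)
    (f := fun x : Plane => (∑ i, c i * x i) + d) (g := φ) ?_ ?_ ?_ (fun x _ => hdiff x)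
    (fun x _ => hφ.1.differentiable (by simp) x)
  · simp only [hfd] at key
    rw [hφ.setIntegral_eq]
    exact (hd.setIntegral_eq _).trans key
  · simp only [hfd]
    exact (hφ.continuous.const_mul _).integrable_of_hasCompactSupport hφ.2.1.mul_left
  · exact (hcont.mul hd.continuous).integrable_of_hasCompactSupport hd.2.1.mul_left
  · exact (hcont.mul hφ.continuous).integrable_of_hasCompactSupport hφ.2.1.mul_left

end IsWeakGradient

end VonKarman

/-! ### The direct method -/

namespace VonKarman

open Filter Topology

variable {S : Set Plane} {k v : Plane → ℝ}

/-- `v ∈ W^{2,2}(S)` with weak gradient `g` and weak Hessian `h`. -/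
structure IsWeakHessian (S : Set Plane) (v : Plane → ℝ) (g : Fin 2 → Plane → ℝ)
    (h : Fin 2 → Fin 2 → Plane → ℝ) : Prop where
  grad : IsWeakGradient S v g
  hess : ∀ i, IsWeakGradient S (g i) (h i)

lemma exists_isWeakHessian (hv : v ∈ W22 S) : ∃ g h, IsWeakHessian S v g h := by
  obtain ⟨hm, hv⟩ := hv
  choose g hg hgm h hh hhm using hv
  exact ⟨g, h, ⟨hm, hgm, hg⟩, fun i => ⟨hgm i, hhm i, hh i⟩⟩

namespace IsWeakHessian

variable {g : Fin 2 → Plane → ℝ} {h : Fin 2 → Fin 2 → Plane → ℝ}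

lemma mem_W22 (H : IsWeakHessian S v g h) : v ∈ W22 S :=
  ⟨H.grad.memLp, fun i => ⟨g i, H.grad.hasWeakPartial i, H.grad.memLp_grad i, fun j =>
    ⟨h i j, (H.hess i).hasWeakPartial j, (H.hess i).memLp_grad j⟩⟩⟩

/-- The `weakPartial` representatives are arbitrary choices, applied twice. Uniqueness up to null
sets lets any given weak derivatives replace them in the constraint and the energy. -/
lemma weakHessian_ae_eq (hS : IsOpen S) (H : IsWeakHessian S v g h) :
    weakHessian S v =ᵐ[volume.restrict S] fun x => Matrix.of fun i j => h i j x := by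
  have h1 : ∀ i j, weakPartial S j (weakPartial S i v) =ᵐ[volume.restrict S] h i j := fun i j => by
    have hi := weakPartial_ae_eq hS (H.grad.hasWeakPartial i)
    exact weakPartial_ae_eq hS
      (((H.hess i).hasWeakPartial j).congr hi.symm (ae_eq_refl _))
  have h2 : ∀ᵐ x ∂(volume.restrict S), ∀ i j, weakPartial S j (weakPartial S i v) x = h i j x :=
    ae_all_iff.2 fun i => ae_all_iff.2 fun j => h1 i j
  filter_upwards [h2] with x hx
  ext i j
  exact hx i j

lemma mem_W22k_iff (hS : IsOpen S) (H : IsWeakHessian S v g h) :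
    v ∈ W22k S k ↔
      (fun x => h 0 0 x * h 1 1 x - h 0 1 x * h 1 0 x) =ᵐ[volume.restrict S] k := by
  have h1 := H.weakHessian_ae_eq hS
  refine ⟨fun hv => ?_, fun hk => ⟨H.mem_W22, ?_⟩⟩
  · filter_upwards [h1, hv.2] with x hx hx'
    rw [hx, Matrix.det_fin_two] at hx'
    exact hx'
  · filter_upwards [h1, hk] with x hx hx'
    rw [hx, Matrix.det_fin_two]
    exact hx'

lemma energy_eq (hS : IsOpen S) (H : IsWeakHessian S v g h) (hv : v ∈ W22k S k) :
    energy S k v = ENNReal.ofReal (∑ i, ∑ j, ∫ x in S, h i j x ^ 2) := by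
  have hint : ∀ i j, Integrable (fun x => h i j x ^ 2) (volume.restrict S) := fun i j =>
    ((H.hess i).memLp_grad j).integrable_sq
  rw [energy, if_pos hv]
  have h1 : ∑ i, ∑ j, ∫ x in S, h i j x ^ 2 = ∫ x in S, ∑ i, ∑ j, h i j x ^ 2 := by
    rw [integral_finsetSum _ fun i _ => integrable_finsetSum _ fun j _ => hint i j]
    exact Finset.sum_congr rfl fun i _ => (integral_finsetSum _ fun j _ => hint i j).symm
  rw [h1, ofReal_integral_eq_lintegral_ofReal
    (integrable_finsetSum _ fun i _ => integrable_finsetSum _ fun j _ => hint i j)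
    (.of_forall fun x => Finset.sum_nonneg fun i _ => Finset.sum_nonneg fun j _ => sq_nonneg _)]
  refine lintegral_congr_ae ?_
  filter_upwards [H.weakHessian_ae_eq hS] with x hx
  rw [hx]
  rfl

end IsWeakHessian

/-- The Poincaré inequality in terms of real integrals. -/
lemma PoincareOn.exists_integral_le (h : PoincareOn S S) (hSb : volume S ≠ ⊤) :
    ∃ C : ℝ, 0 ≤ C ∧ ∀ u g, IsWeakGradient S u g →
      ∃ c : ℝ, ∫ x in S, (u x - c) ^ 2 ≤ C * ∑ i, ∫ x in S, g i x ^ 2 := by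
  obtain ⟨C, hC, h⟩ := h
  have : IsFiniteMeasure (volume.restrict S) := ⟨by simpa using hSb.lt_top⟩
  refine ⟨C.toReal, ENNReal.toReal_nonneg, fun u g hu => ?_⟩
  obtain ⟨u', hum, huu', hu'⟩ := hu.exists_measurable
  obtain ⟨c, hc⟩ := h u' g hum hu'
  refine ⟨c, ?_⟩
  have hm : MemLp (fun x => u' x - c) 2 (volume.restrict S) := hu'.memLp.sub (memLp_const c)
  have h0 : 0 ≤ ∑ i, ∫ x in S, g i x ^ 2 :=
    Finset.sum_nonneg fun i _ => integral_nonneg fun x => sq_nonneg _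
  rw [hm.lintegral_enorm_sq, gradSq_eq_ofReal hu.memLp_grad, ← ENNReal.ofReal_toReal hC,
    ← ENNReal.ofReal_mul ENNReal.toReal_nonneg,
    ENNReal.ofReal_le_ofReal_iff (mul_nonneg ENNReal.toReal_nonneg h0)] at hc
  refine le_of_eq_of_le (integral_congr_ae ?_) hc
  filter_upwards [huu'] with x hx
  rw [hx]

/-- After subtraction of an affine function, the Hessian controls the lower order terms. -/
lemma exists_normalized_of_poincare (hS : IsOpen S) (hSb : Bornology.IsBounded S)
    (hP : PoincareOn S S) :
    ∃ C : ℝ, ∀ v g h, IsWeakHessian S v g h → ∀ E, ∑ i, ∑ j, ∫ x in S, h i j x ^ 2 ≤ E →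
      ∃ v' g', IsWeakHessian S v' g' h ∧ ∫ x in S, v' x ^ 2 ≤ C * E ∧
        ∀ i, ∫ x in S, g' i x ^ 2 ≤ C * E := by
  obtain ⟨C, hC, hP⟩ := hP.exists_integral_le hSb.measure_lt_top.ne
  -- Poincaré on each gradient component gives C·E; a second use on v minus the linear part, whose
  -- two gradient components total at most 2·C·E, gives C·(2·C)·E.
  refine ⟨max C (C * (2 * C)), fun v g h H E hE => ?_⟩
  have hnn : ∀ i, 0 ≤ ∑ j, ∫ x in S, h i j x ^ 2 := fun i =>
    Finset.sum_nonneg fun j _ => integral_nonneg fun x => sq_nonneg _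
  have hE0 : 0 ≤ E := (Finset.sum_nonneg fun i _ => hnn i).trans hE
  have hhE : ∀ i, ∑ j, ∫ x in S, h i j x ^ 2 ≤ E := fun i =>
    (Finset.single_le_sum (fun i _ => hnn i) (Finset.mem_univ i)).trans hE
  choose c hc using fun i => hP (g i) (h i) (H.hess i)
  have hg' : ∀ i, ∫ x in S, (g i x - c i) ^ 2 ≤ C * E := fun i =>
    (hc i).trans (mul_le_mul_of_nonneg_left (hhE i) hC)
  have H1 := H.grad.sub (.affine hSb hS 0 c)
  obtain ⟨d, hd⟩ := hP _ _ H1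
  have H2 := H.grad.sub (.affine hSb hS d c)
  refine ⟨_, _, ⟨H2, fun i => ?_⟩, ?_, fun i => (hg' i).trans ?_⟩
  · have := (H.hess i).sub (.affine hSb hS (c i) 0)
    simpa using this
  · have h1 : ∑ i, ∫ x in S, (g i x - c i) ^ 2 ≤ 2 * C * E := by
      rw [Fin.sum_univ_two]
      linarith [hg' 0, hg' 1]
    calc _ = ∫ x in S, (v x - ((∑ i, c i * x i) + 0) - d) ^ 2 := by
          refine integral_congr_ae (.of_forall fun x => ?_)
          simp only
          ring
      _ ≤ C * (2 * C * E) := hd.trans (mul_le_mul_of_nonneg_left h1 hC)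
      _ = C * (2 * C) * E := by ring
      _ ≤ _ := mul_le_mul_of_nonneg_right (le_max_right _ _) hE0
  · exact mul_le_mul_of_nonneg_right (le_max_left _ _) hE0

/-- Weak lower semicontinuity of the square integral. -/
lemma le_of_tendsto_integral_mul {ι : Type*} [Fintype ι] {a : ι → ℕ → Plane → ℝ}
    {A : ι → Plane → ℝ} (ha : ∀ i n, MemLp (a i n) 2 (volume.restrict S))
    (hA : ∀ i, MemLp (A i) 2 (volume.restrict S))
    (hlim : ∀ i f, MemLp f 2 (volume.restrict S) →
      Tendsto (fun n => ∫ x in S, a i n x * f x) atTop (𝓝 (∫ x in S, A i x * f x)))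
    {m : ℝ≥0∞}
    (hm : Tendsto (fun n => ENNReal.ofReal (∑ i, ∫ x in S, a i n x ^ 2)) atTop (𝓝 m)) :
    ENNReal.ofReal (∑ i, ∫ x in S, A i x ^ 2) ≤ m := by
  -- From (a - A)² ≥ 0 comes a² ≥ 2aA - A², whose right side is affine in a and so passes to the
  -- weak limit.
  have h1 : Tendsto (fun n => ∑ i, (2 * (∫ x in S, a i n x * A i x) - ∫ x in S, A i x ^ 2)) atTop
      (𝓝 (∑ i, ∫ x in S, A i x ^ 2)) := by
    refine tendsto_finsetSum _ fun i _ => ?_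
    have := ((hlim i _ (hA i)).const_mul 2).sub_const (∫ x in S, A i x ^ 2)
    simp only [← sq] at this
    convert this using 2
    ring
  refine le_of_tendsto_of_tendsto' (ENNReal.tendsto_ofReal h1) hm fun n => ?_
  refine ENNReal.ofReal_le_ofReal (Finset.sum_le_sum fun i _ => ?_)
  have i1 : Integrable (fun x => a i n x * A i x) (volume.restrict S) :=
    (ha i n).integrable_mul (hA i)
  rw [← integral_const_mul, ← integral_sub (i1.const_mul 2) (hA i).integrable_sq]
  exact integral_mono ((i1.const_mul 2).sub (hA i).integrable_sq) (ha i n).integrable_sq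
    fun x => by nlinarith [sq_nonneg (a i n x - A i x)]

/-- Weak continuity of the Jacobian determinant. -/
lemma jacobian_ae_eq_of_tendsto (hS : IsOpen S) (hSb : Bornology.IsBounded S)
    {f g : ℕ → Plane → ℝ} {p q : ℕ → Fin 2 → Plane → ℝ} {F G : Plane → ℝ}
    {P Q : Fin 2 → Plane → ℝ} (hf : ∀ n, IsWeakGradient S (f n) (p n))
    (hg : ∀ n, IsWeakGradient S (g n) (q n)) (hF : IsWeakGradient S F P)
    (hG : IsWeakGradient S G Q) {C : ℝ} (hfC : ∀ n, ∫ x in S, f n x ^ 2 ≤ C)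
    (hpC : ∀ n i, ∫ x in S, p n i x ^ 2 ≤ C) (hqC : ∀ n i, ∫ x in S, q n i x ^ 2 ≤ C)
    (hfF : ∀ ψ, MemLp ψ 2 (volume.restrict S) →
      Tendsto (fun n => ∫ x in S, f n x * ψ x) atTop (𝓝 (∫ x in S, F x * ψ x)))
    (hqQ : ∀ i ψ, MemLp ψ 2 (volume.restrict S) →
      Tendsto (fun n => ∫ x in S, q n i x * ψ x) atTop (𝓝 (∫ x in S, Q i x * ψ x)))
    (hdet : ∀ n, (fun x => p n 0 x * q n 1 x - p n 1 x * q n 0 x) =ᵐ[volume.restrict S] k) :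
    (fun x => P 0 x * Q 1 x - P 1 x * Q 0 x) =ᵐ[volume.restrict S] k := by
  have hSv : volume S ≠ ⊤ := hSb.measure_lt_top.ne
  have hsq : ∀ {a b : Plane → ℝ}, MemLp a 2 (volume.restrict S) → MemLp b 2 (volume.restrict S) →
      ∫ x in S, (a x - b x) ^ 2 ≤ 2 * (∫ x in S, a x ^ 2) + 2 * ∫ x in S, b x ^ 2 := by
    intro a b ha hb
    rw [← integral_const_mul, ← integral_const_mul,
      ← integral_add (ha.integrable_sq.const_mul 2) (hb.integrable_sq.const_mul 2)]
    exact integral_mono (ha.sub hb).integrable_sq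
      ((ha.integrable_sq.const_mul 2).add (hb.integrable_sq.const_mul 2))
      fun x => by nlinarith [sq_nonneg (a x + b x)]
  have hstrong : ∀ K, IsCompact K → K ⊆ S →
      Tendsto (fun n => ∫⁻ x in K, ‖f n x - F x‖ₑ ^ 2) atTop (𝓝 0) := by
    intro K hK hKS
    refine tendsto_lintegral_sq_of_weak hS hSb hK hKS (fun n => (hf n).sub hF)
      (M := 2 * C + 2 * ∫ x in S, F x ^ 2)
      (fun n => (hsq (hf n).memLp hF.memLp).trans (by linarith [hfC n]))
      (A := ENNReal.ofReal (∑ i, (2 * C + 2 * ∫ x in S, P i x ^ 2))) ENNReal.ofReal_ne_top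
      (fun n => ?_) fun ψ hψ => ?_
    · rw [gradSq_eq_ofReal ((hf n).sub hF).memLp_grad]
      refine ENNReal.ofReal_le_ofReal (Finset.sum_le_sum fun i _ => ?_)
      exact (hsq ((hf n).memLp_grad i) (hF.memLp_grad i)).trans (by linarith [hpC n i])
    · have h1 := (hfF ψ hψ).sub_const (∫ x in S, F x * ψ x)
      rw [sub_self] at h1
      refine h1.congr fun n => ?_
      have i1 : Integrable (fun x => f n x * ψ x) (volume.restrict S) :=
        (hf n).memLp.integrable_mul hψ
      have i2 : Integrable (fun x => F x * ψ x) (volume.restrict S) := hF.memLp.integrable_mul hψ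
      rw [← integral_sub i1 i2]
      simp only [sub_mul]
  have hloc : ∀ {p q : Fin 2 → Plane → ℝ}, (∀ i, MemLp (p i) 2 (volume.restrict S)) →
      (∀ i, MemLp (q i) 2 (volume.restrict S)) →
      LocallyIntegrableOn (fun x => p 0 x * q 1 x - p 1 x * q 0 x) S := by
    intro p q hp hq
    have : Integrable (fun x => p 0 x * q 1 x - p 1 x * q 0 x) (volume.restrict S) :=
      ((hp 0).integrable_mul (hq 1)).sub ((hp 1).integrable_mul (hq 0))
    exact IntegrableOn.locallyIntegrableOn this
  have hlocPQ := hloc hF.memLp_grad hG.memLp_grad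
  have hlock : LocallyIntegrableOn k S :=
    (hloc (hf 0).memLp_grad (hg 0).memLp_grad).congr_ae_restrict (hdet 0)
  have hzero := ae_eq_zero_of_integral_test hS (hlocPQ.sub hlock) fun φ hφ => by
    have h0 := hφ.fderiv_apply (basisVec 0)
    have h1 := hφ.fderiv_apply (basisVec 1)
    have hsplit : ∀ {f : Plane → ℝ} {q : Fin 2 → Plane → ℝ}, MemLp f 2 (volume.restrict S) →
        (∀ i, MemLp (q i) 2 (volume.restrict S)) →
        ∫ x in S, f x * (q 1 x * fderiv ℝ φ x (basisVec 0) - q 0 x * fderiv ℝ φ x (basisVec 1)) =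
          (∫ x in S, f x * (q 1 x * fderiv ℝ φ x (basisVec 0))) -
            ∫ x in S, f x * (q 0 x * fderiv ℝ φ x (basisVec 1)) := by
      intro f q hf hq
      have i0 : Integrable (fun x => f x * (q 1 x * fderiv ℝ φ x (basisVec 0)))
          (volume.restrict S) := hf.integrable_mul (h0.memLp_mul (hq 1))
      have i1 : Integrable (fun x => f x * (q 0 x * fderiv ℝ φ x (basisVec 1)))
          (volume.restrict S) := hf.integrable_mul (h1.memLp_mul (hq 0))
      rw [← integral_sub i0 i1]
      simp only [mul_sub]
    have hlim := ((tendsto_integral_mul_mul_test h0 (fun n => (hf n).memLp) hF.memLp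
      (fun n => (hg n).memLp_grad 1) (fun n => hqC n 1) (hstrong _ h0.2.1 h0.2.2) (hqQ 1)).sub
      (tendsto_integral_mul_mul_test h1 (fun n => (hf n).memLp) hF.memLp
      (fun n => (hg n).memLp_grad 0) (fun n => hqC n 0) (hstrong _ h1.2.1 h1.2.2) (hqQ 0))).neg
    -- The limit is now the tested Jacobian of the limit pair, while each term of the sequence
    -- equals the constant ∫ k φ.
    rw [← hsplit hF.memLp hG.memLp_grad, ← hF.integral_jacobian_mul hS hSv hG hφ] at hlim
    have hconst : ∫ x in S, (P 0 x * Q 1 x - P 1 x * Q 0 x) * φ x = ∫ x in S, k x * φ x := by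
      refine tendsto_nhds_unique hlim (tendsto_const_nhds.congr fun n => ?_)
      rw [← hsplit (hf n).memLp (hg n).memLp_grad, ← (hf n).integral_jacobian_mul hS hSv (hg n) hφ]
      exact integral_congr_ae ((hdet n).symm.mul (ae_eq_refl φ))
    simp only [Pi.sub_apply, sub_mul (_ - _)]
    rw [integral_sub (hφ.integrableOn_mul hlocPQ) (hφ.integrableOn_mul hlock), hconst, sub_self]
  filter_upwards [hzero] with x hx
  exact sub_eq_zero.1 hx

/-- Existence of minimizers in the nonempty case. -/
lemma exists_energy_le (hS : IsOpen S) (hSb : Bornology.IsBounded S) (hP : PoincareOn S S)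
    (hne : (W22k S k).Nonempty) : ∃ v ∈ W22k S k, ∀ w, energy S k v ≤ energy S k w := by
  obtain ⟨C, hC⟩ := exists_normalized_of_poincare hS hSb hP
  obtain ⟨s, hs_anti, hs_lim, hs_mem⟩ := exists_seq_tendsto_sInf
    (hne.image (energy S k)) (OrderBot.bddBelow _)
  choose w hw hws using hs_mem
  choose g₀ h hH₀ using fun n => exists_isWeakHessian (hw n).1
  have hE : ∀ n, s n = ENNReal.ofReal (∑ i, ∑ j, ∫ x in S, h n i j x ^ 2) := fun n =>
    (hws n).symm.trans ((hH₀ n).energy_eq hS (hw n))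
  set E := ∑ i, ∑ j, ∫ x in S, h 0 i j x ^ 2
  have hE0 : 0 ≤ E := Finset.sum_nonneg fun i _ => Finset.sum_nonneg fun j _ =>
    integral_nonneg fun x => sq_nonneg _
  have hhE : ∀ n, ∑ i, ∑ j, ∫ x in S, h n i j x ^ 2 ≤ E := fun n => by
    -- The minimizing sequence is antitone, so the first energy bounds them all.
    have := hs_anti (Nat.zero_le n)
    rwa [hE, hE, ENNReal.ofReal_le_ofReal_iff hE0] at this
  choose v g hH hv hg using fun n => hC _ _ _ (hH₀ n) E (hhE n)
  set R := max (C * E) E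
  have hhR : ∀ n i j, ∫ x in S, h n i j x ^ 2 ≤ R := fun n i j => by
    refine le_trans ?_ ((hhE n).trans (le_max_right _ _))
    refine (Finset.single_le_sum (f := fun j => ∫ x in S, h n i j x ^ 2)
      (fun j _ => integral_nonneg fun x => sq_nonneg _) (Finset.mem_univ j)).trans ?_
    exact Finset.single_le_sum (f := fun i => ∑ j, ∫ x in S, h n i j x ^ 2)
      (fun i _ => Finset.sum_nonneg fun j _ => integral_nonneg fun x => sq_nonneg _)
      (Finset.mem_univ i)
  -- Function, gradient and Hessian entries are indexed together to share one subsequence.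
  let u : Unit ⊕ Fin 2 ⊕ Fin 2 × Fin 2 → ℕ → Plane → ℝ :=
    Sum.elim (fun _ n => v n) (Sum.elim (fun i n => g n i) fun ij n => h n ij.1 ij.2)
  obtain ⟨θ, hθ, U, hU, hlim⟩ := exists_subseq_tendsto_integral (S := S) (u := u) (C := R)
    (by
      rintro (_ | i | ⟨i, j⟩) n
      exacts [(hH n).grad.memLp, (hH n).grad.memLp_grad i, ((hH n).hess i).memLp_grad j])
    (by
      rintro (_ | i | ⟨i, j⟩) n
      exacts [(hv n).trans (le_max_left _ _), (hg n i).trans (le_max_left _ _), hhR n i j])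
  set V := U (.inl ())
  set G : Fin 2 → Plane → ℝ := fun i => U (.inr (.inl i)) with hGdef
  set H : Fin 2 → Fin 2 → Plane → ℝ := fun i j => U (.inr (.inr (i, j))) with hHdef
  have hlimV : ∀ f, MemLp f 2 (volume.restrict S) → Tendsto (fun n => ∫ x in S, v (θ n) x * f x)
      atTop (𝓝 (∫ x in S, V x * f x)) := hlim (.inl ())
  have hlimG : ∀ i f, MemLp f 2 (volume.restrict S) →
      Tendsto (fun n => ∫ x in S, g (θ n) i x * f x) atTop (𝓝 (∫ x in S, G i x * f x)) :=
    fun i => hlim (.inr (.inl i))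
  have hlimH : ∀ i j f, MemLp f 2 (volume.restrict S) →
      Tendsto (fun n => ∫ x in S, h (θ n) i j x * f x) atTop (𝓝 (∫ x in S, H i j x * f x)) :=
    fun i j => hlim (.inr (.inr (i, j)))
  have hVGH : IsWeakHessian S V G H :=
    ⟨⟨hU _, fun i => hU _, fun i => .of_tendsto
        (fun n => (hH (θ n)).grad.hasWeakPartial i) (hU _) (hU _) hlimV (hlimG i)⟩,
      fun i => ⟨hU _, fun j => hU _, fun j => .of_tendsto
        (fun n => ((hH (θ n)).hess i).hasWeakPartial j) (hU _) (hU _) (hlimG i) (hlimH i j)⟩⟩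
  -- Normalization leaves `h` unchanged, so the determinant equation of the original `w (θ n)` still
  -- holds.
  have hdet := jacobian_ae_eq_of_tendsto (k := k) hS hSb (fun n => (hH (θ n)).hess 0)
    (fun n => (hH (θ n)).hess 1) (hVGH.hess 0) (hVGH.hess 1) (C := R)
    (fun n => (hg (θ n) 0).trans (le_max_left _ _)) (fun n i => hhR (θ n) 0 i)
    (fun n i => hhR (θ n) 1 i) (hlimG 0) (hlimH 1)
    fun n => ((hH₀ (θ n)).mem_W22k_iff hS).1 (hw (θ n))
  have hV : V ∈ W22k S k := (hVGH.mem_W22k_iff hS).2 hdet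
  refine ⟨V, hV, fun z => ?_⟩
  by_cases hz : z ∈ W22k S k
  · refine le_trans ?_ (sInf_le (mem_image_of_mem (energy S k) hz))
    have hs' := hs_lim.comp hθ.tendsto_atTop
    have := le_of_tendsto_integral_mul (a := fun (ij : Fin 2 × Fin 2) n => h (θ n) ij.1 ij.2)
      (A := fun ij => H ij.1 ij.2) (fun ij n => ((hH (θ n)).hess ij.1).memLp_grad ij.2)
      (fun ij => hU _) (fun ij => hlimH ij.1 ij.2) (m := sInf (energy S k '' W22k S k)) (by
        refine hs'.congr fun n => ?_
        rw [Function.comp_apply, hE, Fintype.sum_prod_type])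
    rwa [Fintype.sum_prod_type, ← hVGH.energy_eq hS hV] at this
  · rw [energy, energy, if_neg hz]
    exact le_top

end VonKarman

theorem mainTheorem1 (S : Set VonKarman.Plane) (hS : VonKarman.IsSmoothSimplyConnectedDomain S)
    (k : VonKarman.Plane → ℝ) (hk : ContDiffOn ℝ ∞ k (closure S)) :
    ∃ v ∈ VonKarman.W22 S,
      (∀ w : VonKarman.Plane → ℝ, VonKarman.energy S k v ≤ VonKarman.energy S k w) ∧
      ((VonKarman.W22k S k).Nonempty → v ∈ VonKarman.W22k S k) := by
  by_cases hne : (VonKarman.W22k S k).Nonempty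
  · obtain ⟨v, hv, hmin⟩ := VonKarman.exists_energy_le hS.isOpen hS.isBounded
      (VonKarman.poincareOn_self hS) hne
    exact ⟨v, hv.1, hmin, fun _ => hv⟩
  -- With no admissible function every energy is +∞, and the zero function serves as v.
  · have h0 : VonKarman.IsWeakGradient S (fun _ => 0) fun _ _ => 0 := by
      simpa using VonKarman.IsWeakGradient.affine hS.isBounded hS.isOpen 0 0
    have hH : VonKarman.IsWeakHessian S (fun _ => 0) (fun _ _ => 0) fun _ _ _ => 0 :=
      ⟨h0, fun _ => h0⟩
    refine ⟨_, hH.mem_W22, fun w => ?_, fun h => absurd h hne⟩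
    have hw : w ∉ VonKarman.W22k S k := fun hw => hne ⟨w, hw⟩
    rw [VonKarman.energy, VonKarman.energy, if_neg hw]
    exact le_top
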